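/- Let $U$ be a connected Riemann surface, $x$ a non-constant meromorphic function on $U$, and let $K$ be a functional differential field on $(U,x)$, i.e. a subfield of the field of meromorphic functions on $U$ that contains all complex constants and is closed under the derivation $f\mapsto f'=df/dx$. Multivalued functions on $U$ are understood through their analytic germs, up to analytic continuation. The \emph{basic elementary functions} are the complex constants, the independent variable $z$, $\exp$, $\ln$, $z^\alpha$ ($\alpha\in\mathbb C$), $\sin,\cos,\tan,\cot$, and the inverse trigonometric functions $\arcsin,\arccos,\arctan,\operatorname{arccot}$. The \emph{generalized elementary functions of one variable} are the (multivalued) functions on $\mathbb C$ obtained from the basic elementary functions by repeated application of composition, arithmetic operations, differentiation, solving algebraic equations $y^n+f_1y^{n-1}+\dots+f_n=0$, and analytic continuation. The \emph{generalized elementary functions over $K$} are the (multivalued) functions on $U$ obtained from the functions in $K$ by repeated application of composition $f\mapsto\varphi\circ f$ with generalized elementary functions $\varphi$ of one variable, arithmetic operations, the derivation $d/dx$, solving algebraic equations, and analytic continuation. \textbf{Liouville's First Theorem.} Let $f\in K$ and let $y$ be an integral of $f$, i.e. an analytic germ at a point $p\in U$ with $dy/dx=f$ near $p$. Then $y$ is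 a germ of a generalized elementary function over $K$ if and only if there are $m\ge 0$, functions $r_0,r_1,\dots,r_m\in K$ and complex constants $\lambda_1,\dots,\lambda_m$ such that $$y=r_0+\sum_{i=1}^m\lambda_i\ln r_i$$ near $p$, in the sense that in a neighbourhood of every point $q\neq p$ sufficiently close to $p$ this identity holds for suitable branches of the logarithms $\ln r_i$. -/

import Mathlib

open Filter Topology
open scoped Manifold ContDiff

noncomputable section

namespace Liouville

/-! ### Functions on a Riemann surface -/

section Surface

variable {U : Type*} [TopologicalSpace U] [ChartedSpace ℂ U]

/-- `f`, read in the preferred chart at `p`. -/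
def inChart (f : U → ℂ) (p : U) : ℂ → ℂ := f ∘ (chartAt ℂ p).symm

/-- `f` is holomorphic in a neighbourhood of `p`, i.e. it defines an analytic germ at `p`. -/
def HolAt (f : U → ℂ) (p : U) : Prop := AnalyticAt ℂ (inChart f p) (chartAt ℂ p p)

/-- `f` is meromorphic on `U`.  As for Mathlib's `MeromorphicAt`, the values of `f` on a closed
discrete set do not matter: two such functions are the same meromorphic function if and only if
they agree off a closed discrete set, i.e. `f =ᶠ[codiscrete U] g`. -/
def IsMeromorphic (f : U → ℂ) : Prop :=
  ∀ p, MeromorphicAt (inChart f p) (chartAt ℂ p p)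

/-- `x` is not a constant meromorphic function. -/
def IsNonconstant (x : U → ℂ) : Prop := ¬ ∃ c : ℂ, x =ᶠ[codiscrete U] fun _ => c

/-- The coordinate derivative of `f` at `p`, in the preferred chart at `p`. -/
def chartDeriv (f : U → ℂ) (p : U) : ℂ := deriv (inChart f p) (chartAt ℂ p p)

/-- The derivative `df / dx` with respect to the function `x`.  The ratio does not depend on the
chart wherever `f` and `x` are holomorphic and `dx ≠ 0`. -/
def derivWrt (x f : U → ℂ) : U → ℂ := fun p => chartDeriv f p / chartDeriv x p

/-- A functional differential field: a differential subfield, containing the complex constants, of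
the field of meromorphic functions on `U` with the derivation `f ↦ df / dx`.  It is given as the
set of all functions `U → ℂ` that represent one of its elements (hence `saturated`); the inverse
of a nonzero element is represented by the pointwise inverse. -/
structure IsFunctionalDifferentialField (x : U → ℂ) (K : Subalgebra ℂ (U → ℂ)) : Prop where
  meromorphic : ∀ f ∈ K, IsMeromorphic f
  saturated : ∀ f ∈ K, ∀ g : U → ℂ, f =ᶠ[codiscrete U] g → g ∈ K
  inv_mem : ∀ f ∈ K, f⁻¹ ∈ K
  deriv_mem : ∀ f ∈ K, derivWrt x f ∈ K

/-- The germ of `g` at `q` is obtained from the germ of `f` at `p` by analytic continuation inside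
one connected open set.  Repeating this gives all analytic continuations along paths. -/
def IsDirectContinuation (f : U → ℂ) (p : U) (g : U → ℂ) (q : U) : Prop :=
  ∃ W : Set U, IsOpen W ∧ IsPreconnected W ∧ p ∈ W ∧ q ∈ W ∧
    ∃ h : U → ℂ, (∀ w ∈ W, HolAt h w) ∧ h =ᶠ[𝓝 p] f ∧ h =ᶠ[𝓝 q] g

end Surface

/-! ### Generalized elementary functions of one complex variable

A multivalued function is represented by its analytic germs; `P f p` means that the germ of `f` at
`p` is a germ of a function of the class `P`. -/

/-- The germs of the basic elementary functions.  The multivalued ones are given by all their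
branches. -/
inductive IsBasicElementary : (ℂ → ℂ) → ℂ → Prop
  | const (c b : ℂ) : IsBasicElementary (fun _ => c) b
  | var (b : ℂ) : IsBasicElementary (fun z => z) b
  | exp (b : ℂ) : IsBasicElementary Complex.exp b
  | log (b : ℂ) (g : ℂ → ℂ) (hg : AnalyticAt ℂ g b) (h : ∀ᶠ z in 𝓝 b, Complex.exp (g z) = z) :
      IsBasicElementary g b
  | pow (α b : ℂ) (g : ℂ → ℂ) (hg : AnalyticAt ℂ g b)
      (h : ∀ᶠ z in 𝓝 b, Complex.exp (g z) = z) :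
      IsBasicElementary (fun z => Complex.exp (α * g z)) b
  | sin (b : ℂ) : IsBasicElementary Complex.sin b
  | cos (b : ℂ) : IsBasicElementary Complex.cos b
  | tan (b : ℂ) (hb : Complex.cos b ≠ 0) : IsBasicElementary Complex.tan b
  | cot (b : ℂ) (hb : Complex.sin b ≠ 0) : IsBasicElementary Complex.cot b
  | arcsin (b : ℂ) (g : ℂ → ℂ) (hg : AnalyticAt ℂ g b)
      (h : ∀ᶠ z in 𝓝 b, Complex.sin (g z) = z) : IsBasicElementary g b
  | arccos (b : ℂ) (g : ℂ → ℂ) (hg : AnalyticAt ℂ g b)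
      (h : ∀ᶠ z in 𝓝 b, Complex.cos (g z) = z) : IsBasicElementary g b
  | arctan (b : ℂ) (g : ℂ → ℂ) (hg : AnalyticAt ℂ g b)
      (h : ∀ᶠ z in 𝓝 b, Complex.sin (g z) = z * Complex.cos (g z)) : IsBasicElementary g b
  | arccot (b : ℂ) (g : ℂ → ℂ) (hg : AnalyticAt ℂ g b)
      (h : ∀ᶠ z in 𝓝 b, Complex.cos (g z) = z * Complex.sin (g z)) : IsBasicElementary g b

/-- Generalized elementary functions of one variable: generated by the basic elementary functions
under composition, arithmetic operations, differentiation, solving algebraic equations, and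
analytic continuation. -/
inductive IsGenElementary : (ℂ → ℂ) → ℂ → Prop
  | basic {f : ℂ → ℂ} {b : ℂ} (hf : IsBasicElementary f b) : IsGenElementary f b
  | continuation {f g : ℂ → ℂ} {b c : ℂ} (hf : IsGenElementary f b)
      (h : IsDirectContinuation f b g c) : IsGenElementary g c
  | comp {f g : ℂ → ℂ} {b : ℂ} (hf : IsGenElementary f (g b)) (hg : IsGenElementary g b) :
      IsGenElementary (fun z => f (g z)) b
  | add {f g : ℂ → ℂ} {b : ℂ} (hf : IsGenElementary f b) (hg : IsGenElementary g b) :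
      IsGenElementary (fun z => f z + g z) b
  | sub {f g : ℂ → ℂ} {b : ℂ} (hf : IsGenElementary f b) (hg : IsGenElementary g b) :
      IsGenElementary (fun z => f z - g z) b
  | mul {f g : ℂ → ℂ} {b : ℂ} (hf : IsGenElementary f b) (hg : IsGenElementary g b) :
      IsGenElementary (fun z => f z * g z) b
  | div {f g : ℂ → ℂ} {b : ℂ} (hf : IsGenElementary f b) (hg : IsGenElementary g b)
      (h : g b ≠ 0) : IsGenElementary (fun z => f z / g z) b
  | deriv {f : ℂ → ℂ} {b : ℂ} (hf : IsGenElementary f b) : IsGenElementary (deriv f) b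
  | solve {n : ℕ} {c : Fin n → ℂ → ℂ} {y : ℂ → ℂ} {b : ℂ} (hc : ∀ i, IsGenElementary (c i) b)
      (hy : AnalyticAt ℂ y b)
      (h : ∀ᶠ z in 𝓝 b, y z ^ n + ∑ i, c i z * y z ^ (i : ℕ) = 0) : IsGenElementary y b

section Over

variable {U : Type*} [TopologicalSpace U] [ChartedSpace ℂ U]

/-- Generalized elementary functions over `K`: generated by the functions of `K` under
composition `f ↦ φ ∘ f` with generalized elementary functions `φ` of one variable, arithmetic
operations, differentiation, solving algebraic equations, and analytic continuation. -/
inductive IsGenElementaryOver (x : U → ℂ) (K : Subalgebra ℂ (U → ℂ)) : (U → ℂ) → U → Prop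
  | basic {f : U → ℂ} {p : U} (hf : f ∈ K) (hp : HolAt f p) : IsGenElementaryOver x K f p
  | continuation {f g : U → ℂ} {p q : U} (hf : IsGenElementaryOver x K f p)
      (h : IsDirectContinuation f p g q) : IsGenElementaryOver x K g q
  | comp {φ : ℂ → ℂ} {f : U → ℂ} {p : U} (hφ : IsGenElementary φ (f p))
      (hf : IsGenElementaryOver x K f p) : IsGenElementaryOver x K (fun u => φ (f u)) p
  | add {f g : U → ℂ} {p : U} (hf : IsGenElementaryOver x K f p)
      (hg : IsGenElementaryOver x K g p) : IsGenElementaryOver x K (fun u => f u + g u) p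
  | sub {f g : U → ℂ} {p : U} (hf : IsGenElementaryOver x K f p)
      (hg : IsGenElementaryOver x K g p) : IsGenElementaryOver x K (fun u => f u - g u) p
  | mul {f g : U → ℂ} {p : U} (hf : IsGenElementaryOver x K f p)
      (hg : IsGenElementaryOver x K g p) : IsGenElementaryOver x K (fun u => f u * g u) p
  | div {f g : U → ℂ} {p : U} (hf : IsGenElementaryOver x K f p)
      (hg : IsGenElementaryOver x K g p) (h : g p ≠ 0) :
      IsGenElementaryOver x K (fun u => f u / g u) p
  | deriv {f : U → ℂ} {p : U} (hf : IsGenElementaryOver x K f p) (hx : HolAt x p)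
      (h : chartDeriv x p ≠ 0) : IsGenElementaryOver x K (derivWrt x f) p
  | solve {n : ℕ} {c : Fin n → U → ℂ} {y : U → ℂ} {p : U}
      (hc : ∀ i, IsGenElementaryOver x K (c i) p) (hy : HolAt y p)
      (h : ∀ᶠ u in 𝓝 p, y u ^ n + ∑ i, c i u * y u ^ (i : ℕ) = 0) :
      IsGenElementaryOver x K y p

/-- The germ of `y` at `p` is a germ of an integral of `f`, i.e. `dy / dx = f`. -/
def IsIntegralOf (x f y : U → ℂ) (p : U) : Prop :=
  HolAt y p ∧ derivWrt x y =ᶠ[𝓝[≠] p] f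

/-- `L` is a branch of `ln r` at `q`. -/
def IsLogBranch (r L : U → ℂ) (q : U) : Prop :=
  HolAt L q ∧ ∀ᶠ u in 𝓝 q, Complex.exp (L u) = r u

/-- `y = r₀ + ∑ λᵢ ln rᵢ` near `p`, with `r₀, …, r_m ∈ K` and complex constants `λᵢ`.  The points
near `p` other than `p` itself are used, since some `rᵢ` may have a zero or a pole at `p`. -/
def IsLogSum (K : Subalgebra ℂ (U → ℂ)) (y : U → ℂ) (p : U) : Prop :=
  ∃ (m : ℕ) (r₀ : U → ℂ) (r : Fin m → U → ℂ) (c : Fin m → ℂ), r₀ ∈ K ∧ (∀ i, r i ∈ K) ∧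
    ∀ᶠ q in 𝓝[≠] p, ∃ L : Fin m → U → ℂ, (∀ i, IsLogBranch (r i) (L i) q) ∧
      ∀ᶠ u in 𝓝 q, y u = r₀ u + ∑ i, c i * L i u

end Over

end Liouville

end

/-!
Germs of meromorphic functions at a point, with the derivation `d / dx`, form a differential field
with constants `ℂ`. Every elementary germ lies in an extension of this field and is obtained from
the germs of `K` by finitely many equations: algebraic ones, those of an exponential `b′ = b * a′`,
and those of a logarithm `a * b′ = a′` (sine, cosine and their inverses are algebraic over
`exp (i z)`). To compose with `φ`, form the tensor product of the extension that contains `f` with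
the one that contains `φ`, the derivation of the latter being rescaled by `df / dx`; so the
extensions are differential rings, not necessarily fields. To continue along a connected set `W`,
extend scalars through the ring of functions meromorphic on `W`, which has, modulo functions that
vanish almost everywhere, an embedding in the field of germs at each point of `W`.

Liouville's theorem then holds for such differential rings. As only finitely many elements occur in
the equations, the ring may be taken of countable dimension; modulo a maximal differential ideal it
is a domain, and its field of fractions has no new constants: a new constant `c` would be
transcendental, and the elements `(c - z)⁻¹`, `z ∈ ℂ`, would be uncountably many and independent. In
that field a subfield with Liouville's property that is maximal is closed under all elementary
operations; for a transcendental exponential or logarithm `t` this follows by comparing coefficients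
of the Laurent series in `t` or in `1 / t`. Hence `dy / dx = dr₀ / dx + ∑ λᵢ (drᵢ / dx) / rᵢ`.

Near every point of a small punctured disc this integrates to `y = r₀ + C + ∑ λᵢ ln rᵢ`. The
possible constants `C` form a coset of the group of the `∑ λᵢ 2πi nᵢ`, which is locally constant, so
that one `C` serves the whole disc. Conversely, a branch of `ln r` is a branch of `ln` composed with
`r`, and `y` is the continuation to `p` of its germ at a nearby point.
-/

noncomputable section

namespace ElementaryIntegral

open Liouville
open scoped Differential

universe u

section IsElementary

variable {R R' : Type*} [CommRing R] [Differential R] [CommRing R'] [Differential R']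

/-- The elements of a differential ring that are elementary over the set `S`. All the closure
conditions are equations, so that homomorphisms of differential rings preserve them: `b` in `exp`
is an exponential of `a`, `b` in `log` a logarithm of `a`, and `e` witnesses invertibility. -/
inductive IsElementary (S : Set R) : R → Prop
  | base {a : R} (h : a ∈ S) : IsElementary S a
  | one : IsElementary S 1
  | add {a b : R} (ha : IsElementary S a) (hb : IsElementary S b) : IsElementary S (a + b)
  | sub {a b : R} (ha : IsElementary S a) (hb : IsElementary S b) : IsElementary S (a - b)
  | mul {a b : R} (ha : IsElementary S a) (hb : IsElementary S b) : IsElementary S (a * b)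
  | inv {a b : R} (ha : IsElementary S a) (h : a * b = 1) : IsElementary S b
  | deriv {a : R} (ha : IsElementary S a) : IsElementary S a′
  | alg {n : ℕ} {c : Fin n → R} {b : R} (hc : ∀ i, IsElementary S (c i))
      (h : b ^ n + ∑ i, c i * b ^ (i : ℕ) = 0) : IsElementary S b
  | exp {a b e : R} (ha : IsElementary S a) (hb : b * e = 1) (h : b′ = b * a′) : IsElementary S b
  | log {a b e : R} (ha : IsElementary S a) (he : a * e = 1) (h : b′ * a = a′) : IsElementary S b

variable {S : Set R} {S' : Set R'}

theorem IsElementary.map_of_isUnit {a : R} (ha : IsElementary S a) (k : R →+* R') {u : R'}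
    (hu : IsUnit u) (hue : IsElementary S' u) (hk : ∀ a, (k a)′ = u * k a′)
    (hS : ∀ a ∈ S, IsElementary S' (k a)) : IsElementary S' (k a) := by
  obtain ⟨v, huv⟩ := hu.exists_right_inv
  induction ha with
  | base h => exact hS _ h
  | one => rw [map_one]; exact one
  | add _ _ iha ihb => rw [map_add]; exact iha.add ihb
  | sub _ _ iha ihb => rw [map_sub]; exact iha.sub ihb
  | mul _ _ iha ihb => rw [map_mul]; exact iha.mul ihb
  | inv _ h ih => exact ih.inv (by rw [← map_mul, h, map_one])
  | @deriv a _ ih =>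
    have hka : k a′ = v * (k a)′ := by
      rw [hk]; linear_combination (-k a′) * huv
    rw [hka]
    exact (hue.inv huv).mul ih.deriv
  | @alg n c b _ h ih =>
    refine alg (c := fun i => k (c i)) ih ?_
    simpa only [map_add, map_pow, map_sum, map_mul, map_zero] using congr(k $h)
  | exp _ hb h ih =>
    refine ih.exp (e := k _) (by rw [← map_mul, hb, map_one]) ?_
    rw [hk, hk, h, map_mul]; ring
  | log _ he h ih =>
    refine ih.log (e := k _) (by rw [← map_mul, he, map_one]) ?_
    rw [hk, hk, ← h, map_mul]; ring

theorem IsElementary.map {a : R} (ha : IsElementary S a) (k : R →+* R') (hk : ∀ a, (k a)′ = k a′)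
    (hS : ∀ a ∈ S, IsElementary S' (k a)) : IsElementary S' (k a) :=
  ha.map_of_isUnit k isUnit_one .one (fun a => by rw [hk, one_mul]) hS

theorem IsElementary.algebraMap_image [Algebra R R'] [DifferentialAlgebra R R'] {a : R}
    (ha : IsElementary S a) : IsElementary (algebraMap R R' '' S) (algebraMap R R' a) :=
  ha.map _ deriv_algebraMap fun _ h => .base ⟨_, h, rfl⟩

end IsElementary

section TensorProduct

open TensorProduct

variable {F A B : Type*} [CommRing F] [Differential F] [CommRing A] [Differential A]
  [CommRing B] [Differential B] [Algebra F A] [DifferentialAlgebra F A] [Algebra F B]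

theorem deriv_smul_of_deriv_algebraMap {u : B}
    (hu : ∀ r : F, (algebraMap F B r)′ = u * algebraMap F B r′) (r : F) (b : B) :
    (r • b)′ = r • b′ + r′ • (u * b) := by
  rw [Algebra.smul_def, Derivation.leibniz, hu, smul_eq_mul, smul_eq_mul, Algebra.smul_def r,
    Algebra.smul_def r′]
  ring

variable {u : B} (hu : ∀ r : F, (algebraMap F B r)′ = u * algebraMap F B r′)

/-- The additive map underlying `tensorDeriv`. -/
def tensorDerivAddHom : A ⊗[F] B →+ A ⊗[F] B :=
  TensorProduct.liftAddHom
    (AddMonoidHom.mk' (fun a => AddMonoidHom.mk' (fun b => a′ ⊗ₜ (u * b) + a ⊗ₜ b′)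
        fun b b' => by simp only [mul_add, map_add, tmul_add]; abel)
      fun a a' => by
        ext b
        simp only [AddMonoidHom.mk'_apply, AddMonoidHom.add_apply, map_add, add_tmul]; abel)
    fun r a b => by
      have ha : (r • a)′ = r • a′ + r′ • a := by
        rw [deriv_smul_of_deriv_algebraMap (u := 1) (fun s => by rw [deriv_algebraMap, one_mul]),
          one_mul]
      simp only [AddMonoidHom.mk'_apply, ha, deriv_smul_of_deriv_algebraMap hu, add_tmul,
        tmul_add, smul_tmul, mul_smul_comm]
      abel

theorem tensorDerivAddHom_tmul (a : A) (b : B) :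
    tensorDerivAddHom hu (a ⊗ₜ b) = a′ ⊗ₜ (u * b) + a ⊗ₜ b′ := rfl

theorem tensorDerivAddHom_mul (s t : A ⊗[F] B) :
    tensorDerivAddHom hu (s * t) = s * tensorDerivAddHom hu t + t * tensorDerivAddHom hu s := by
  induction s with
  | zero => simp only [zero_mul, map_zero, mul_zero, add_zero]
  | add s s' hs hs' => simp only [add_mul, map_add, hs, hs', mul_add]; abel
  | tmul a b =>
    induction t with
    | zero => simp only [zero_mul, map_zero, mul_zero, add_zero]
    | add t t' ht ht' => simp only [add_mul, map_add, ht, ht', mul_add]; abel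
    | tmul a' b' =>
      simp only [Algebra.TensorProduct.tmul_mul_tmul, tensorDerivAddHom_tmul, Derivation.leibniz,
        smul_eq_mul, add_tmul, tmul_add, mul_add]
      rw [mul_comm a' a, mul_left_comm b u b', mul_left_comm b' u b, mul_comm b' b]
      abel

/-- The derivation `a ⊗ b ↦ a′ ⊗ u b + a ⊗ b′` of `A ⊗[F] B`, when `A` is a differential algebra
over `F` and the structure map of `B` multiplies derivatives by `u`. -/
def tensorDeriv : Derivation ℤ (A ⊗[F] B) (A ⊗[F] B) :=
  Derivation.mk' (tensorDerivAddHom hu).toIntLinearMap (tensorDerivAddHom_mul hu)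

theorem tensorDeriv_tmul (a : A) (b : B) :
    tensorDeriv hu (a ⊗ₜ b) = a′ ⊗ₜ (u * b) + a ⊗ₜ b′ := rfl

theorem tensorDeriv_includeLeft (a : A) :
    tensorDeriv hu (a ⊗ₜ 1) = (1 ⊗ₜ u) * (a′ ⊗ₜ 1) := by
  rw [tensorDeriv_tmul, Algebra.TensorProduct.tmul_mul_tmul, Derivation.map_one_eq_zero, tmul_zero,
    add_zero, one_mul]

theorem tensorDeriv_includeRight (b : B) :
    tensorDeriv hu ((1 : A) ⊗ₜ b) = 1 ⊗ₜ b′ := by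
  rw [tensorDeriv_tmul, Derivation.map_one_eq_zero, zero_tmul, zero_add]

end TensorProduct

section InExtension

open TensorProduct

theorem exists_twisted_amalgam {F A B : Type u} [Field F] [Differential F] [CommRing A]
    [Nontrivial A] [Differential A] [CommRing B] [Nontrivial B] [Differential B] [Algebra F A]
    [DifferentialAlgebra F A] [Algebra F B] {u : B}
    (hu : ∀ r : F, (algebraMap F B r)′ = u * algebraMap F B r′) :
    ∃ (T : Type u) (_ : CommRing T) (_ : Nontrivial T) (_ : Differential T) (i : A →+* T)
      (j : B →+* T), (∀ a, (i a)′ = j u * i a′) ∧ (∀ b, (j b)′ = j b′) ∧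
        ∀ r, i (algebraMap F A r) = j (algebraMap F B r) :=
  ⟨A ⊗[F] B, inferInstance, inferInstance, ⟨tensorDeriv hu⟩,
    Algebra.TensorProduct.includeLeftRingHom,
    (Algebra.TensorProduct.includeRight : B →ₐ[F] A ⊗[F] B), tensorDeriv_includeLeft hu,
    tensorDeriv_includeRight hu, Algebra.TensorProduct.tmul_one_eq_one_tmul⟩

variable {M : Type u} [Field M] [Differential M] {S : Set M}

/-- `g` becomes elementary over `S` in some nontrivial differential algebra over the differential
field `M`. -/
def IsElementaryInExtension (S : Set M) (g : M) : Prop :=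
  ∃ (L : Type u) (_ : CommRing L) (_ : Nontrivial L) (_ : Differential L) (_ : Algebra M L)
    (_ : DifferentialAlgebra M L), IsElementary (algebraMap M L '' S) (algebraMap M L g)

theorem IsElementary.isElementaryInExtension {g : M} (hg : IsElementary S g) :
    IsElementaryInExtension S g :=
  ⟨M, inferInstance, inferInstance, inferInstance, inferInstance, inferInstance,
    hg.algebraMap_image⟩

theorem IsElementary.inv₀ {a : M} (ha : IsElementary S a) : IsElementary S a⁻¹ := by
  rcases eq_or_ne a 0 with rfl | h
  · rwa [inv_zero]
  · exact ha.inv (mul_inv_cancel₀ h)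

theorem IsElementary.isElementaryInExtension_of_ringHom {L : Type u} [CommRing L] [Nontrivial L]
    [Differential L] (j : M →+* L) (hj : ∀ a, (j a)′ = j a′) {g : M}
    (hg : IsElementary (j '' S) (j g)) : IsElementaryInExtension S g :=
  ⟨L, inferInstance, inferInstance, inferInstance, j.toAlgebra,
    @DifferentialAlgebra.mk _ _ _ _ j.toAlgebra _ _ hj, hg⟩

theorem isElementaryInExtension_of_twist {F A B : Type u} [Field F] [Differential F]
    [CommRing A] [Nontrivial A] [Differential A] [CommRing B] [Nontrivial B]
    [Differential B] [Algebra F A] [DifferentialAlgebra F A] [Algebra M B]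
    [DifferentialAlgebra M B] (k : F →+* M) {u : M} (hu : u ≠ 0)
    (hk : ∀ a, (k a)′ = u * k a′) {S₀ : Set F}
    (hue : IsElementary (algebraMap M B '' S) (algebraMap M B u))
    (hS : ∀ a ∈ S₀, IsElementary (algebraMap M B '' S) (algebraMap M B (k a))) {g : F}
    (hg : IsElementary (algebraMap F A '' S₀) (algebraMap F A g)) :
    IsElementaryInExtension S (k g) := by
  let : Algebra F B := ((algebraMap M B).comp k).toAlgebra
  obtain ⟨T, _, _, _, i, j, hi, hj, hij⟩ := exists_twisted_amalgam (A := A) (B := B)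
    (u := algebraMap M B u) fun r : F => by
      rw [RingHom.algebraMap_toAlgebra, RingHom.comp_apply, RingHom.comp_apply, deriv_algebraMap,
        hk, map_mul]
  have hjT {b : B} (hb : IsElementary (algebraMap M B '' S) b) :
      IsElementary (j.comp (algebraMap M B) '' S) (j b) :=
    hb.map j hj fun _ ⟨s, hs, h⟩ => .base ⟨s, hs, congr(j $h)⟩
  refine IsElementary.isElementaryInExtension_of_ringHom (j.comp (algebraMap M B))
    (fun a => by rw [RingHom.comp_apply, hj, deriv_algebraMap, RingHom.comp_apply]) ?_
  change IsElementary _ (j (algebraMap F B g))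
  rw [← hij]
  refine hg.map_of_isUnit i ((hu.isUnit.map (algebraMap M B)).map j) (hjT hue) hi ?_
  rintro _ ⟨s, hs, rfl⟩
  rw [hij]
  exact hjT (hS s hs)

theorem IsElementaryInExtension.comp {M₀ : Type u} [Field M₀] [Differential M₀] (k : M₀ →+* M)
    {u f : M} (hu : u ≠ 0) (hk : ∀ a, (k a)′ = u * k a′) {S₀ : Set M₀}
    (hf : IsElementaryInExtension S f) (hue : IsElementary (insert f S) u)
    (hS : ∀ a ∈ S₀, IsElementary (insert f S) (k a)) {g : M₀}
    (hg : IsElementaryInExtension S₀ g) : IsElementaryInExtension S (k g) := by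
  obtain ⟨A, _, _, _, _, _, hg⟩ := hg
  obtain ⟨B, _, _, _, _, _, hf⟩ := hf
  have hB {a : M} (ha : IsElementary (insert f S) a) :
      IsElementary (algebraMap M B '' S) (algebraMap M B a) := by
    refine ha.map _ deriv_algebraMap ?_
    rintro a (rfl | ha)
    exacts [hf, .base ⟨a, ha, rfl⟩]
  exact isElementaryInExtension_of_twist k hu hk (hB hue) (fun a ha => hB (hS a ha)) hg

theorem IsElementaryInExtension.transfer {F M' : Type u} [Field F] [Differential F] [Field M']
    [Differential M'] [Algebra F M] [DifferentialAlgebra F M] [Algebra F M']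
    [DifferentialAlgebra F M'] {S₀ : Set F} {g : F}
    (hg : IsElementaryInExtension (algebraMap F M '' S₀) (algebraMap F M g)) :
    IsElementaryInExtension (algebraMap F M' '' S₀) (algebraMap F M' g) := by
  obtain ⟨L, _, _, _, _, _, hg⟩ := hg
  let : Algebra F L := ((algebraMap M L).comp (algebraMap F M)).toAlgebra
  have : DifferentialAlgebra F L := ⟨fun a => by
    rw [RingHom.algebraMap_toAlgebra, RingHom.comp_apply, RingHom.comp_apply, deriv_algebraMap,
      deriv_algebraMap]⟩
  rw [Set.image_image] at hg
  exact isElementaryInExtension_of_twist (A := L) (B := M') (algebraMap F M') one_ne_zero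
    (fun a => by rw [deriv_algebraMap, one_mul])
    (by rw [map_one]; exact .one)
    (fun a ha => .base (Set.mem_image_of_mem _ (Set.mem_image_of_mem _ ha))) hg

theorem exists_extension_forall_isElementary {n : ℕ} {c : Fin n → M}
    (hc : ∀ i, IsElementaryInExtension S (c i)) :
    ∃ (L : Type u) (_ : CommRing L) (_ : Nontrivial L) (_ : Differential L) (j : M →+* L),
      (∀ a, (j a)′ = j a′) ∧ ∀ i, IsElementary (j '' S) (j (c i)) := by
  induction n with
  | zero => exact ⟨M, inferInstance, inferInstance, inferInstance, RingHom.id M, fun _ => rfl,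
      fun i => i.elim0⟩
  | succ n ih =>
    obtain ⟨B, _, _, _, jB, hjB, hB⟩ := ih fun i => hc i.castSucc
    obtain ⟨A, _, _, _, _, _, hA⟩ := hc (Fin.last n)
    let := jB.toAlgebra
    obtain ⟨T, _, _, _, i, j, hi, hj, hij⟩ := exists_twisted_amalgam (A := A) (B := B) (u := 1)
      fun r : M => (hjB r).trans (one_mul _).symm
    refine ⟨T, inferInstance, inferInstance, inferInstance, j.comp jB,
      fun a => by rw [RingHom.comp_apply, hj, hjB, RingHom.comp_apply],
      Fin.lastCases ?_ fun l => ?_⟩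
    · rw [RingHom.comp_apply, ← RingHom.algebraMap_toAlgebra jB, ← hij]
      refine hA.map i (fun a => by rw [hi, map_one, one_mul]) ?_
      rintro _ ⟨s, hs, rfl⟩
      exact .base ⟨s, hs, (hij s).symm⟩
    · exact (hB l).map j hj fun _ ⟨s, hs, h⟩ => .base ⟨s, hs, congr(j $h)⟩

theorem IsElementaryInExtension.of_isElementary_range {n : ℕ} {c : Fin n → M}
    (hc : ∀ i, IsElementaryInExtension S (c i)) {g : M}
    (hg : IsElementary (Set.range c) g) : IsElementaryInExtension S g := by
  obtain ⟨L, _, _, _, j, hj, hL⟩ := exists_extension_forall_isElementary hc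
  refine IsElementary.isElementaryInExtension_of_ringHom j hj (hg.map j hj ?_)
  rintro _ ⟨i, rfl⟩
  exact hL i

theorem IsElementaryInExtension.of_isElementary_pair {a b g : M}
    (ha : IsElementaryInExtension S a) (hb : IsElementaryInExtension S b)
    (hg : IsElementary {a, b} g) : IsElementaryInExtension S g :=
  of_isElementary_range (c := ![a, b]) (Fin.forall_fin_two.2 ⟨ha, hb⟩)
    (by rwa [Matrix.range_cons_cons_empty])

theorem IsElementaryInExtension.of_isElementary_singleton {a g : M}
    (ha : IsElementaryInExtension S a) (hg : IsElementary {a} g) : IsElementaryInExtension S g :=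
  ha.of_isElementary_pair ha (by rwa [Set.pair_eq_singleton])

end InExtension

section SubringsAndQuotients

variable {R : Type*} [CommRing R] [Differential R]

/-- The differential ring structure given by an additive map satisfying the Leibniz rule. -/
abbrev differentialOfLeibniz {R : Type*} [CommRing R] (D : R →+ R)
    (hD : ∀ a b, D (a * b) = a * D b + b * D a) : Differential R :=
  ⟨Derivation.mk' D.toIntLinearMap hD⟩

/-- The differential ring structure on a subring stable under the derivation. -/
abbrev subringDifferential {σ : Type*} [SetLike σ R] [SubringClass σ R] (A : σ)
    (hA : ∀ a ∈ A, a′ ∈ A) : Differential A :=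
  differentialOfLeibniz
    (AddMonoidHom.mk' (fun a : A => (⟨(a : R)′, hA a a.2⟩ : A))
      fun a b => Subtype.ext (map_add _ (a : R) b))
    fun a b => Subtype.ext (Derivation.leibniz _ (a : R) b)

/-- The differential ring structure on the quotient by a differential ideal. -/
abbrev quotientDifferential (I : Ideal R) (hI : ∀ a ∈ I, a′ ∈ I) : Differential (R ⧸ I) where
  deriv := Derivation.liftOfSurjective (f := (Ideal.Quotient.mk I).toIntAlgHom)
    (d := Differential.deriv)
    Ideal.Quotient.mk_surjective fun a ha =>
      Ideal.Quotient.eq_zero_iff_mem.2 (hI a (Ideal.Quotient.eq_zero_iff_mem.1 ha))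

theorem quotientDifferential_deriv_mk (I : Ideal R) (hI : ∀ a ∈ I, a′ ∈ I) (a : R) :
    (quotientDifferential I hI).deriv (Ideal.Quotient.mk I a) = Ideal.Quotient.mk I a′ :=
  Derivation.liftOfSurjective_apply ..

theorem IsElementaryInExtension.transfer_of_ringHom {R : Type*} [CommRing R] {M M' : Type u}
    [Field M] [Differential M] [Field M'] [Differential M'] (φ : R →+* M) (φ' : R →+* M')
    (hker : ∀ a, φ a = 0 → φ' a = 0) (hinv : ∀ a, φ a ≠ 0 → ∃ b, φ a * φ b = 1)
    (hderiv : ∀ a, ∃ b, (φ a)′ = φ b ∧ (φ' a)′ = φ' b) {S : Set R} {g : R}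
    (hg : IsElementaryInExtension (φ '' S) (φ g)) : IsElementaryInExtension (φ' '' S) (φ' g) := by
  have hφ : Function.Surjective φ.rangeRestrict := φ.rangeRestrict_surjective
  let ψ : φ.range →+* M' := φ.rangeRestrict.liftOfSurjective hφ
    ⟨φ', fun a ha => hker a (congrArg Subtype.val ha)⟩
  have hψ (a : R) : ψ (φ.rangeRestrict a) = φ' a :=
    RingHom.liftOfRightInverse_comp_apply ..
  let : Field φ.range := IsField.toField
    { exists_pair_ne := ⟨0, 1, zero_ne_one⟩
      mul_comm := mul_comm
      mul_inv_cancel := by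
        intro a ha
        obtain ⟨a, rfl⟩ := hφ a
        obtain ⟨b, hb⟩ := hinv a fun h => ha (Subtype.ext h)
        exact ⟨φ.rangeRestrict b, Subtype.ext hb⟩ }
  let : Differential φ.range := subringDifferential φ.range fun a ⟨r, hr⟩ =>
    let ⟨b, hb, _⟩ := hderiv r
    ⟨b, by rw [← hr, hb]⟩
  let := ψ.toAlgebra
  have : DifferentialAlgebra φ.range M := ⟨fun _ => rfl⟩
  have : DifferentialAlgebra φ.range M' := ⟨fun a => by
    obtain ⟨a, rfl⟩ := hφ a
    obtain ⟨b, hb, hb'⟩ := hderiv a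
    have hab : (φ.rangeRestrict a)′ = φ.rangeRestrict b := Subtype.ext hb
    change (ψ _)′ = ψ _
    rw [hab, hψ, hψ, hb']⟩
  have key := IsElementaryInExtension.transfer (M := M) (M' := M')
    (S₀ := φ.rangeRestrict '' S) (g := φ.rangeRestrict g) (by rwa [Set.image_image])
  rw [Set.image_image] at key
  change IsElementaryInExtension ((ψ <| φ.rangeRestrict ·) '' S) (ψ (φ.rangeRestrict g)) at key
  simpa only [hψ] using key

end SubringsAndQuotients

section Fractions

open KaehlerDifferential TensorProduct

variable (S Q : Type*) [CommRing S] [Differential S] [Field Q] [Algebra S Q]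
  [IsFractionRing S Q]

/-- The differential field structure on the field of fractions `Q` of a differential ring `S`, given
by the isomorphism `Q ⊗[S] Ω[S⁄ℤ] ≃ Ω[Q⁄ℤ]`. -/
abbrev fractionDifferential : Differential Q where
  deriv :=
    have := Algebra.FormallyEtale.of_isLocalization (Rₘ := Q) (nonZeroDivisors S)
    let d : Derivation ℤ S Q := (Algebra.linearMap S Q).compDer Differential.deriv
    LinearMap.compDer (LinearMap.liftBaseChange Q d.liftKaehlerDifferential ∘ₗ
      (tensorKaehlerEquivOfFormallyEtale ℤ S Q).symm.toLinearMap) (D ℤ Q)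

theorem fractionDifferential_deriv_algebraMap (a : S) :
    (fractionDifferential S Q).deriv (algebraMap S Q a) = algebraMap S Q a′ := by
  have := Algebra.FormallyEtale.of_isLocalization (Rₘ := Q) (nonZeroDivisors S)
  let d : Derivation ℤ S Q := (Algebra.linearMap S Q).compDer Differential.deriv
  calc
    _ = LinearMap.liftBaseChange Q d.liftKaehlerDifferential (1 ⊗ₜ D ℤ S a) :=
      congrArg (LinearMap.liftBaseChange Q _)
        (tensorKaehlerEquivOfFormallyEtale_symm_D_algebraMap ℤ S Q a)
    _ = d a := by
      rw [LinearMap.liftBaseChange_tmul, one_smul, Derivation.liftKaehlerDifferential_comp_D]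

end Fractions

section Simple

variable (R : Type*) [CommRing R] [Differential R]

/-- A differential ring without proper nonzero differential ideals. -/
def IsDifferentialSimple : Prop :=
  ∀ I : Ideal R, (∀ a ∈ I, a′ ∈ I) → I = ⊥ ∨ I = ⊤

theorem exists_quotient_isDifferentialSimple [Nontrivial R] :
    ∃ (I : Ideal R) (hI : ∀ a ∈ I, a′ ∈ I), I ≠ ⊤ ∧
      let _ := quotientDifferential I hI
      IsDifferentialSimple (R ⧸ I) := by
  obtain ⟨I, hI⟩ := zorn_le₀ {I : Ideal R | (∀ a ∈ I, a′ ∈ I) ∧ I ≠ ⊤} fun c hc hchain => by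
    rcases c.eq_empty_or_nonempty with rfl | hne
    · exact ⟨⊥, ⟨by simp, bot_ne_top⟩, by simp⟩
    have hmem {a : R} : a ∈ sSup c ↔ ∃ J ∈ c, a ∈ J :=
      Submodule.mem_sSup_of_directed hne hchain.directedOn
    refine ⟨sSup c, ⟨fun a ha => ?_, ?_⟩, fun J hJ => le_sSup hJ⟩
    · obtain ⟨J, hJ, haJ⟩ := hmem.1 ha
      exact hmem.2 ⟨J, hJ, (hc hJ).1 a haJ⟩
    · rw [Ne, Ideal.eq_top_iff_one, hmem]
      rintro ⟨J, hJ, h1⟩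
      exact (hc hJ).2 ((Ideal.eq_top_iff_one J).2 h1)
  refine ⟨I, hI.prop.1, hI.prop.2, fun J hJ => or_iff_not_imp_right.2 fun hJ' => ?_⟩
  have hle : J.comap (Ideal.Quotient.mk I) ≤ I := by
    refine hI.le_of_ge ⟨fun a ha => ?_, by rwa [Ne, Ideal.comap_eq_top_iff]⟩ fun a ha => ?_
    · rw [Ideal.mem_comap, ← quotientDifferential_deriv_mk I hI.prop.1]
      exact hJ _ ha
    · rw [Ideal.mem_comap, Ideal.Quotient.eq_zero_iff_mem.2 ha]
      exact J.zero_mem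
  rw [eq_bot_iff]
  intro b hb
  obtain ⟨a, rfl⟩ := Ideal.Quotient.mk_surjective b
  exact Ideal.Quotient.eq_zero_iff_mem.2 (hle hb)

/-- The elements killed by some power of `a`. -/
def powAnnihilator {R : Type*} [CommRing R] (a : R) : Ideal R where
  carrier := {b | ∃ n : ℕ, a ^ n * b = 0}
  zero_mem' := ⟨0, mul_zero _⟩
  add_mem' := by
    rintro x y ⟨n, hn⟩ ⟨m, hm⟩
    exact ⟨n + m, by rw [pow_add]; linear_combination a ^ m * hn + a ^ n * hm⟩
  smul_mem' := by
    rintro c x ⟨n, hn⟩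
    exact ⟨n, by rw [smul_eq_mul]; linear_combination c * hn⟩

variable {R}

theorem deriv_pow_succ (a : R) (n : ℕ) : (a ^ (n + 1))′ = (n + 1 : ℕ) * a ^ n * a′ := by
  rw [Derivation.leibniz_pow, Nat.add_sub_cancel, nsmul_eq_mul, smul_eq_mul, mul_assoc]

theorem deriv_mem_powAnnihilator (a : R) : ∀ x ∈ powAnnihilator a, x′ ∈ powAnnihilator a := by
  rintro x ⟨n, hn⟩
  have hD : (a ^ (n + 1) * x)′ = 0 := by rw [pow_succ', mul_assoc, hn, mul_zero, map_zero]
  rw [Derivation.leibniz, deriv_pow_succ, smul_eq_mul, smul_eq_mul] at hD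
  exact ⟨n + 1, by linear_combination hD - ((n + 1 : ℕ) : R) * a′ * hn⟩

theorem IsDifferentialSimple.eq_zero_of_mul_eq_zero (hR : IsDifferentialSimple R) {a b : R}
    (ha : ¬ IsNilpotent a) (hab : a * b = 0) : b = 0 := by
  have hb : b ∈ powAnnihilator a := ⟨1, by rwa [pow_one]⟩
  rcases hR _ (deriv_mem_powAnnihilator a) with h | h
  · rwa [h] at hb
  · obtain ⟨n, hn⟩ := (Ideal.eq_top_iff_one _).1 h
    exact absurd ⟨n, by rwa [mul_one] at hn⟩ ha

/-- Differentiating `a ^ (n + 1) = 0` shows that `a′` is nilpotent or that `a ^ n = 0`. -/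
theorem IsDifferentialSimple.isNilpotent_deriv [Algebra ℚ R] (hR : IsDifferentialSimple R) {a : R}
    (ha : IsNilpotent a) : IsNilpotent a′ := by
  by_contra hDa
  obtain ⟨n, hn⟩ := ha
  induction n with
  | zero => exact hDa ⟨1, (eq_zero_of_zero_eq_one (by rw [← hn, pow_zero]) _)⟩
  | succ n ih =>
    have hunit : IsUnit ((n + 1 : ℕ) : R) := by
      simpa only [map_natCast] using
        (IsUnit.mk0 ((n + 1 : ℕ) : ℚ) (Nat.cast_ne_zero.2 n.succ_ne_zero)).map (algebraMap ℚ R)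
    have hD := deriv_pow_succ a n
    rw [hn, map_zero, mul_comm] at hD
    exact ih (hunit.mul_right_eq_zero.1 (hR.eq_zero_of_mul_eq_zero hDa hD.symm))

theorem IsDifferentialSimple.isDomain [Nontrivial R] [Algebra ℚ R]
    (hR : IsDifferentialSimple R) : IsDomain R := by
  have hnil : nilradical R = ⊥ :=
    (hR _ fun a ha => hR.isNilpotent_deriv ha).resolve_right fun h =>
      not_isNilpotent_one ((Ideal.eq_top_iff_one _).1 h)
  have : NoZeroDivisors R := ⟨fun {a b} hab => or_iff_not_imp_left.2 fun ha =>
    hR.eq_zero_of_mul_eq_zero (fun h => ha (by rwa [← mem_nilradical, hnil] at h)) hab⟩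
  exact NoZeroDivisors.to_isDomain R

end Simple

section Laurent

open HahnSeries Differential
open scoped LaurentSeries

section Derivation

variable {F : Type*} [CommRing F]

/-- The coefficientwise map `∑ aₙ Xⁿ ↦ ∑ δₙ(aₙ) Xⁿ` of Laurent series. -/
def coeffMap (δ : ℤ → F →+ F) : F⸨X⸩ →+ F⸨X⸩ where
  toFun x := (⟨fun n => δ n (x.coeff n),
    x.isPWO_support.mono fun n hn h => hn (by simp only [h, map_zero])⟩ : HahnSeries ℤ F)
  map_zero' := HahnSeries.ext (funext fun n => map_zero (δ n))
  map_add' x y := HahnSeries.ext (funext fun n => map_add (δ n) (x.coeff n) (y.coeff n))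

theorem coeff_coeffMap (δ : ℤ → F →+ F) (x : F⸨X⸩) (n : ℤ) :
    (coeffMap δ x).coeff n = δ n (x.coeff n) := rfl

theorem support_coeffMap_subset (δ : ℤ → F →+ F) (x : F⸨X⸩) :
    (coeffMap δ x).support ⊆ x.support := fun n hn h =>
  hn (by rw [coeff_coeffMap, h, map_zero])

theorem coeffMap_mul (δ : ℤ → F →+ F)
    (hδ : ∀ i j a b, δ (i + j) (a * b) = a * δ j b + b * δ i a) (x y : F⸨X⸩) :
    coeffMap δ (x * y) = x * coeffMap δ y + y * coeffMap δ x := by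
  refine HahnSeries.ext (funext fun n => ?_)
  rw [HahnSeries.coeff_add, mul_comm y,
    HahnSeries.coeff_mul_right' y.isPWO_support (support_coeffMap_subset δ y),
    HahnSeries.coeff_mul_left' x.isPWO_support (support_coeffMap_subset δ x),
    ← Finset.sum_add_distrib]
  simp only [coeff_coeffMap, HahnSeries.coeff_mul, map_sum]
  refine Finset.sum_congr rfl fun ij hij => ?_
  rw [Finset.mem_antidiagonal] at hij
  rw [← hij.2.2, hδ]
  ring

/-- The Euler operator `X * d/dX` of Laurent series. -/
def eulerOperator : F⸨X⸩ →+ F⸨X⸩ := coeffMap fun n => AddMonoidHom.mulLeft (n : F)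

theorem eulerOperator_mul (x y : F⸨X⸩) :
    eulerOperator (x * y) = x * eulerOperator y + y * eulerOperator x :=
  coeffMap_mul _ (fun i j a b => by simp only [AddMonoidHom.coe_mulLeft, Int.cast_add]; ring) x y

variable [Differential F]

/-- The differential ring structure on `F⸨X⸩` extending that of `F` with `X′ = η * X ^ (k + 1)`: the
sum of the coefficientwise derivation and of `η * X ^ (k + 1) * d/dX`. -/
abbrev laurentDifferential (k : ℕ) (η : F) : Differential F⸨X⸩ :=
  differentialOfLeibniz (coeffMap (fun _ => ((Differential.deriv : Derivation ℤ F F) : F →+ F)) +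
    (AddMonoidHom.mulLeft (single (k : ℤ) η)).comp eulerOperator) fun x y => by
      simp only [AddMonoidHom.add_apply, AddMonoidHom.comp_apply, AddMonoidHom.coe_mulLeft,
        eulerOperator_mul]
      rw [coeffMap_mul _ fun _ _ a b => Derivation.leibniz Differential.deriv a b]
      ring

variable (k : ℕ) (η : F)

theorem coeff_laurentDifferential_deriv (x : F⸨X⸩) (n : ℤ) :
    ((laurentDifferential k η).deriv x).coeff n =
      (x.coeff n)′ + η * (((n - k : ℤ) : F) * x.coeff (n - k)) := by
  change (coeffMap _ x + (single (k : ℤ) η : F⸨X⸩) * coeffMap _ x).coeff n = _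
  rw [HahnSeries.coeff_add, HahnSeries.coeff_single_mul]
  rfl

theorem laurentDifferential_deriv_C (a : F) :
    (laurentDifferential k η).deriv (C a : F⸨X⸩) = C a′ := by
  refine HahnSeries.ext (funext fun n => ?_)
  rw [coeff_laurentDifferential_deriv]
  simp only [C_apply, coeff_single]
  split_ifs <;> simp_all

theorem laurentDifferential_deriv_X :
    (laurentDifferential k η).deriv (single 1 1 : F⸨X⸩) = C η * (single 1 1 : F⸨X⸩) ^ (k + 1) := by
  refine HahnSeries.ext (funext fun n => ?_)
  rw [coeff_laurentDifferential_deriv, single_pow, C_mul_eq_smul, coeff_smul]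
  simp only [coeff_single]
  split_ifs <;> simp_all
  omega

end Derivation

section IsLiouville

variable {F : Type*} [Field F]

theorem coeff_zero_of_mul_eq {w u v : F⸨X⸩} (hu : u ≠ 0) (h : w * u = v)
    (hv : ∀ n < u.order, v.coeff n = 0) :
    (∀ n < 0, w.coeff n = 0) ∧ w.coeff 0 * u.leadingCoeff = v.coeff u.order := by
  rcases eq_or_ne w 0 with rfl | hw
  · rw [zero_mul] at h
    simp only [← h, HahnSeries.coeff_zero, zero_mul, implies_true, and_self]
  have hlead : v.coeff (w.order + u.order) ≠ 0 := by
    rw [← h, HahnSeries.coeff_mul_order_add_order]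
    exact mul_ne_zero (leadingCoeff_ne_zero.2 hw) (leadingCoeff_ne_zero.2 hu)
  have hord : 0 ≤ w.order := not_lt.1 fun hlt => hlead (hv _ (by omega))
  refine ⟨fun n hn => coeff_eq_zero_of_lt_order (by omega), ?_⟩
  rcases hord.eq_or_lt with h0 | h0
  · rw [← h, ← zero_add u.order, h0, HahnSeries.coeff_mul_order_add_order, ← h0,
      leadingCoeff_eq, leadingCoeff_eq, ← h0]
  · rw [coeff_eq_zero_of_lt_order h0, zero_mul, ← h, coeff_eq_zero_of_lt_order]
    rw [HahnSeries.order_mul hw hu]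
    omega

theorem coeff_C_mul (c : F) (x : F⸨X⸩) (n : ℤ) : (C c * x).coeff n = c * x.coeff n := by
  rw [C_mul_eq_smul, coeff_smul, smul_eq_mul]

variable [Differential F]

theorem coeff_logDeriv (k : ℕ) (η : F) (x : F⸨X⸩) :
    let _ := laurentDifferential k η
    (∀ n < 0, (logDeriv x).coeff n = 0) ∧
      (logDeriv x).coeff 0 = logDeriv x.leadingCoeff + if k = 0 then η * x.order else 0 := by
  intro _
  rcases eq_or_ne x 0 with rfl | hx
  · simp
  obtain ⟨hneg, hzero⟩ := coeff_zero_of_mul_eq hx (div_mul_cancel₀ (x′) hx) fun n hn => by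
    rw [coeff_laurentDifferential_deriv, coeff_eq_zero_of_lt_order hn,
      coeff_eq_zero_of_lt_order (show n - k < x.order by omega), map_zero, mul_zero, mul_zero,
      add_zero]
  refine ⟨hneg, mul_right_cancel₀ (leadingCoeff_ne_zero.2 hx) (hzero.trans ?_)⟩
  rw [coeff_laurentDifferential_deriv, ← leadingCoeff_eq, add_mul, Differential.logDeriv,
    div_mul_cancel₀ _ (leadingCoeff_ne_zero.2 hx)]
  split_ifs with hk
  · rw [hk, Nat.cast_zero, sub_zero, ← leadingCoeff_eq, mul_assoc]
  · rw [coeff_eq_zero_of_lt_order (show x.order - k < x.order by omega), mul_zero, mul_zero,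
      zero_mul]

theorem differentialAlgebra_laurentDifferential (k : ℕ) (η : F) :
    let _ := laurentDifferential k η
    DifferentialAlgebra F F⸨X⸩ := by
  intro _
  refine ⟨fun a => ?_⟩
  rw [LaurentSeries.algebraMap_apply, LaurentSeries.algebraMap_apply, laurentDifferential_deriv_C]

theorem coeff_logForm (k : ℕ) (η : F) {a : F} {ι : Type*} [Fintype ι] {c : ι → F} {u : ι → F⸨X⸩}
    {v : F⸨X⸩} (n : ℤ) :
    let _ := laurentDifferential k η
    algebraMap F F⸨X⸩ a = ∑ i, algebraMap F F⸨X⸩ (c i) * logDeriv (u i) + v′ →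
    (C a : F⸨X⸩).coeff n = ∑ i, c i * (logDeriv (u i)).coeff n +
      ((v.coeff n)′ + η * (((n - k : ℤ) : F) * v.coeff (n - k))) := by
  intro _ h
  have hn := congrArg (fun x : F⸨X⸩ => x.coeff n) h
  simpa only [LaurentSeries.algebraMap_apply, HahnSeries.coeff_add, coeff_sum, coeff_C_mul,
    coeff_laurentDifferential_deriv] using hn

/-- Liouville's theorem for the adjunction of an exponential of `a₀`. -/
theorem isLiouville_laurentDifferential_zero (a₀ : F) :
    let _ := laurentDifferential 0 a₀′
    let _ := differentialAlgebra_laurentDifferential 0 a₀′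
    IsLiouville F F⸨X⸩ := by
  intro _ _
  refine ⟨fun a ι _ c hc u v h => ⟨ι, inferInstance, c, hc, fun i => (u i).leadingCoeff,
    (∑ i, c i * (u i).order) * a₀ + v.coeff 0, ?_⟩⟩
  have hconst : (∑ i, c i * ((u i).order : F))′ = 0 := by
    simp only [map_sum, Derivation.leibniz, hc, Derivation.map_intCast, smul_zero, add_zero,
      Finset.sum_const_zero]
  have h0 := coeff_logForm 0 a₀′ 0 h
  simp only [(coeff_logDeriv 0 a₀′ _).2, C_apply, coeff_single_same, if_true, Nat.cast_zero,
    sub_zero, Int.cast_zero, zero_mul, mul_zero, add_zero] at h0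
  rw [h0, map_add, Derivation.leibniz, hconst, smul_zero, add_zero, smul_eq_mul, Finset.sum_mul,
    ← add_assoc, ← Finset.sum_add_distrib]
  congr 1
  exact Finset.sum_congr rfl fun i _ => by ring

theorem coeff_eq_zero_of_deriv_coeff_eq [CharZero F] {θ : F} (hθ : ∀ e : F, e′ ≠ θ) {v : F⸨X⸩}
    (hv : ∀ n < 0, (v.coeff n)′ = θ * (((n - 1 : ℤ) : F) * v.coeff (n - 1))) :
    ∀ n < -1, v.coeff n = 0 := by
  by_contra! hcon
  obtain ⟨n, hn, hvn⟩ := hcon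
  have hord : v.order < -1 := (order_le_of_coeff_ne_zero hvn).trans_lt hn
  have hlead : v.coeff v.order ≠ 0 := by
    rw [← leadingCoeff_eq]
    exact leadingCoeff_ne_zero.2 fun h0 => hvn (by rw [h0, HahnSeries.coeff_zero])
  have hlead_deriv : (v.coeff v.order)′ = 0 := by
    rw [hv _ (by omega), coeff_eq_zero_of_lt_order (show v.order - 1 < v.order by omega), mul_zero,
      mul_zero]
  have hnext := hv (v.order + 1) (by omega)
  rw [add_sub_cancel_right] at hnext
  have hord0 : (v.order : F) ≠ 0 := Int.cast_ne_zero.2 (by omega)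
  apply hθ (v.coeff (v.order + 1) / (v.order * v.coeff v.order))
  rw [Derivation.leibniz_div_const, hnext, smul_eq_mul, mul_comm θ,
    inv_mul_cancel_left₀ (mul_ne_zero hord0 hlead)]
  rw [Derivation.leibniz, hlead_deriv, Derivation.map_intCast, smul_zero, smul_zero, add_zero]

/-- Liouville's theorem for the adjunction of a logarithm of `a₀`, with `X` standing for its
inverse. -/
theorem isLiouville_laurentDifferential_one [CharZero F] {a₀ : F}
    (ha₀ : ∀ e : F, e′ ≠ logDeriv a₀) :
    let _ := laurentDifferential 1 (-logDeriv a₀)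
    let _ := differentialAlgebra_laurentDifferential 1 (-logDeriv a₀)
    IsLiouville F F⸨X⸩ := by
  intro _ _
  refine ⟨fun a ι _ c hc u v h => ?_⟩
  have hlog (i : ι) := coeff_logDeriv 1 (-logDeriv a₀) (u i)
  have hneg : ∀ n < 0, (v.coeff n)′ = logDeriv a₀ * (((n - 1 : ℤ) : F) * v.coeff (n - 1)) := by
    intro n hn
    have hcoeff := coeff_logForm 1 (-logDeriv a₀) n h
    rw [C_apply, coeff_single_of_ne hn.ne,
      Finset.sum_eq_zero fun i _ => by rw [(hlog i).1 n hn, mul_zero], Nat.cast_one] at hcoeff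
    linear_combination -hcoeff
  have hconst : (v.coeff (-1))′ = 0 := by
    rw [hneg (-1) (by omega), coeff_eq_zero_of_deriv_coeff_eq ha₀ hneg _ (by omega), mul_zero,
      mul_zero]
  refine ⟨Option ι, inferInstance, fun o => o.elim (v.coeff (-1)) c, ?_,
    fun o => o.elim a₀ fun i => (u i).leadingCoeff, v.coeff 0, ?_⟩
  · rintro (_ | i)
    exacts [hconst, hc i]
  · have hcoeff := coeff_logForm 1 (-logDeriv a₀) 0 h
    simp only [(hlog _).2, C_apply, coeff_single_same, one_ne_zero, if_false, add_zero,
      Nat.cast_one, zero_sub, Int.cast_neg, Int.cast_one] at hcoeff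
    rw [hcoeff, Fintype.sum_option]
    simp only [Option.elim]
    ring

end IsLiouville

end Laurent

section Subextension

open IntermediateField Differential
open scoped RatFunc

/-- `a` is the derivative of an expression `v + ∑ cₓ log uₓ` with `v` and `uₓ` in `F` and constants
`cₓ`. This is the form of the conclusion of Mathlib's `IsLiouville`. -/
def HasLogForm {F : Type*} [Field F] [Differential F] (a : F) : Prop :=
  ∃ (ι : Type) (_ : Fintype ι) (c : ι → F) (_ : ∀ x, (c x)′ = 0) (u : ι → F) (v : F),
    a = ∑ x, c x * logDeriv (u x) + v′

theorem HasLogForm.exists_fin (C : Type*) {F : Type*} [CommRing C] [Field F] [Differential F]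
    [Algebra C F] [ContainConstants C F] {a : F} (ha : HasLogForm a) :
    ∃ (m : ℕ) (c : Fin m → C) (u : Fin m → F) (v : F),
      (∀ i, u i ≠ 0) ∧ a = ∑ i, algebraMap C F (c i) * logDeriv (u i) + v′ := by
  obtain ⟨ι, _, c, hc, u, v, rfl⟩ := ha
  have hu (x : ι) : ∃ w : F, w ≠ 0 ∧ logDeriv w = logDeriv (u x) := by
    rcases eq_or_ne (u x) 0 with h | h
    · exact ⟨1, one_ne_zero, by rw [h, logDeriv_one, logDeriv_zero]⟩
    · exact ⟨u x, h, rfl⟩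
  choose c' hc' using fun x => mem_range_of_deriv_eq_zero C (hc x)
  choose w hw₀ hw using hu
  let e := Fintype.equivFin ι
  refine ⟨_, c' ∘ e.symm, w ∘ e.symm, v, fun i => hw₀ _, congrArg (· + v′) ?_⟩
  simp only [Function.comp_apply, hc', hw]
  exact (e.symm.sum_comp _).symm

variable {F L : Type*} [Field F] [Field L] [Algebra F L]

theorem exists_algHom_laurentSeries {t : L} (ht : Transcendental F t) :
    ∃ σ : F⟮t⟯ →ₐ[F] LaurentSeries F, σ (AdjoinSimple.gen F t) = HahnSeries.single 1 1 := by
  let e := RatFunc.algEquivOfTranscendental t ht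
  let ψ : RatFunc F →ₐ[F] LaurentSeries F :=
    { algebraMap (RatFunc F) (LaurentSeries F) with
      commutes' := fun a => by
        change algebraMap (RatFunc F) (LaurentSeries F)
          (algebraMap (Polynomial F) (RatFunc F) (Polynomial.C a)) = _
        rw [← IsScalarTower.algebraMap_apply, LaurentSeries.algebraMap_apply]
        simp }
  refine ⟨ψ.comp e.symm.toAlgHom, ?_⟩
  have hgen : e.symm (AdjoinSimple.gen F t) = RatFunc.X :=
    e.symm_apply_eq.2 (Subtype.ext (RatFunc.algEquivOfTranscendental_X t ht).symm)
  change algebraMap (RatFunc F) (LaurentSeries F) (e.symm (AdjoinSimple.gen F t)) = _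
  rw [hgen, RatFunc.coe_X]

variable [Differential F]

theorem map_deriv_of_adjoin {M : Type*} [Field M] [Differential M] [Algebra F M]
    [DifferentialAlgebra F M] {S : Set L} [Differential (adjoin F S)]
    [DifferentialAlgebra F (adjoin F S)] (σ : adjoin F S →ₐ[F] M)
    (hσ : ∀ s (hs : s ∈ S), (σ ⟨s, subset_adjoin F S hs⟩)′ =
      σ (⟨s, subset_adjoin F S hs⟩ : adjoin F S)′) (u : adjoin F S) :
    (σ u)′ = σ u′ := by
  obtain ⟨u, hu⟩ := u
  induction hu using adjoin_induction with
  | mem s hs => exact hσ s hs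
  | algebraMap a =>
    change (σ (algebraMap F (adjoin F S) a))′ = σ ((algebraMap F (adjoin F S) a)′)
    rw [deriv_algebraMap, AlgHom.commutes, AlgHom.commutes, deriv_algebraMap]
  | add x y hx hy hx' hy' =>
    change (σ (⟨x, hx⟩ + ⟨y, hy⟩))′ = σ ((⟨x, hx⟩ + ⟨y, hy⟩ : adjoin F S)′)
    simp only [map_add, hx', hy']
  | inv x hx hx' =>
    change (σ (⟨x, hx⟩⁻¹))′ = σ ((⟨x, hx⟩⁻¹ : adjoin F S)′)
    simp only [Derivation.leibniz_inv, map_inv₀, smul_eq_mul, map_mul, map_neg, map_pow, hx']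
  | mul x y hx hy hx' hy' =>
    change (σ (⟨x, hx⟩ * ⟨y, hy⟩))′ = σ ((⟨x, hx⟩ * ⟨y, hy⟩ : adjoin F S)′)
    simp only [Derivation.leibniz, map_add, map_mul, smul_eq_mul, hx', hy']

variable [Differential L]

/-- An intermediate field `E` of `L / F` that is stable under the derivation of `L` and is a
Liouville extension of `F`. The second condition is stated inside `L`, since `E` carries no
canonical `Differential` instance. -/
structure IsLiouvilleSubextension (E : IntermediateField F L) : Prop where
  deriv_mem : ∀ a ∈ E, a′ ∈ E
  exists_logForm : ∀ (a : F) (ι : Type) [Fintype ι] (c : ι → F), (∀ x, (c x)′ = 0) →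
    ∀ (u : ι → L) (v : L), (∀ x, u x ∈ E) → v ∈ E →
      algebraMap F L a = ∑ x, algebraMap F L (c x) * logDeriv (u x) + v′ →
      HasLogForm a

theorem isLiouvilleSubextension_of_algHom {M : Type*} [Field M] [Differential M] [Algebra F M]
    [IsLiouville F M] {E : IntermediateField F L} (σ : E →ₐ[F] M)
    (hσ : ∀ u : E, ∃ h : (u : L)′ ∈ E, σ ⟨(u : L)′, h⟩ = (σ u)′) : IsLiouvilleSubextension E := by
  refine ⟨fun u hu => (hσ ⟨u, hu⟩).1, fun a ι _ c hc u v hu hv h => ?_⟩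
  let _ := subringDifferential E fun u hu => (hσ ⟨u, hu⟩).1
  have hlog (w : E) : σ (logDeriv w) = logDeriv (σ w) :=
    (map_div₀ σ _ _).trans (congrArg (· / σ w) (hσ w).2)
  have hE : algebraMap F E a =
      ∑ x, algebraMap F E (c x) * logDeriv (⟨u x, hu x⟩ : E) + (⟨v, hv⟩ : E)′ := by
    refine Subtype.ext (h.trans ?_)
    push_cast
    rfl
  refine IsLiouville.isLiouville a ι c hc (fun x => σ ⟨u x, hu x⟩) (σ ⟨v, hv⟩) ?_
  have hM := congrArg σ hE
  simp only [map_add, map_sum, map_mul, AlgHom.commutes, hlog] at hM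
  exact hM.trans (congrArg _ (hσ ⟨v, hv⟩).2)

theorem isLiouvilleSubextension_iSup {κ : Type*} [Nonempty κ] {E : κ → IntermediateField F L}
    (hdir : Directed (· ≤ ·) E) (hE : ∀ k, IsLiouvilleSubextension (E k)) :
    IsLiouvilleSubextension (⨆ k, E k) := by
  have hmem {w : L} : w ∈ ⨆ k, E k ↔ ∃ k, w ∈ E k := by
    rw [← SetLike.mem_coe, coe_iSup_of_directed hdir, Set.mem_iUnion]
    rfl
  refine ⟨fun u hu => ?_, fun a ι _ c hc u v hu hv h => ?_⟩
  · obtain ⟨k, hk⟩ := hmem.1 hu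
    exact hmem.2 ⟨k, (hE k).deriv_mem u hk⟩
  · choose k hk using fun x => hmem.1 (hu x)
    obtain ⟨k₀, hk₀⟩ := hmem.1 hv
    obtain ⟨l, hl⟩ := (hdir.finite_le fun o : Option ι => o.elim k₀ k)
    exact (hE l).exists_logForm a ι c hc u v (fun x => hl (some x) (hk x)) (hl none hk₀) h

variable [DifferentialAlgebra F L]

theorem differentialAlgebra_subringDifferential (E : IntermediateField F L)
    (hE : ∀ a ∈ E, a′ ∈ E) :
    let _ := subringDifferential E hE
    DifferentialAlgebra F E ∧ DifferentialAlgebra E L := by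
  intro _
  exact ⟨⟨fun a => Subtype.ext (deriv_algebraMap a)⟩, ⟨fun _ => rfl⟩⟩

theorem isLiouvilleSubextension_adjoin_of_isAlgebraic [CharZero F] {t : L}
    (ht : IsAlgebraic F t) : IsLiouvilleSubextension F⟮t⟯ := by
  have := adjoin.finiteDimensional ht.isIntegral
  exact isLiouvilleSubextension_of_algHom (AlgHom.id F F⟮t⟯) fun u =>
    ⟨deriv_algebraMap (A := F⟮t⟯) (B := L) u ▸ Subtype.property _,
      Subtype.ext (deriv_algebraMap (A := F⟮t⟯) (B := L) u)⟩

theorem deriv_mem_adjoin {S : Set L} (hS : ∀ s ∈ S, s′ ∈ adjoin F S) :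
    ∀ u ∈ adjoin F S, u′ ∈ adjoin F S := by
  intro u hu
  induction hu using adjoin_induction with
  | mem s hs => exact hS s hs
  | algebraMap a => exact deriv_algebraMap (B := L) a ▸ IntermediateField.algebraMap_mem _ _
  | add x y _ _ hx hy => exact map_add (Differential.deriv : Derivation ℤ L L) x y ▸ add_mem hx hy
  | inv x hx hx' =>
    rw [Derivation.leibniz_inv]
    exact mul_mem (neg_mem (pow_mem (inv_mem hx) 2)) hx'
  | mul x y hx hy hx' hy' =>
    rw [Derivation.leibniz]
    exact add_mem (mul_mem hx hy') (mul_mem hy hx')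

/-- The embedding of `F(t)` into `F⸨X⸩` with `t ↦ X` respects the derivations if `t` satisfies the
differential equation of `X`. -/
theorem isLiouvilleSubextension_adjoin_of_laurentDifferential (k : ℕ) (η : F) {t : L}
    (ht : Transcendental F t) (hdt : t′ = algebraMap F L η * t ^ (k + 1))
    (hliouville :
      let _ := laurentDifferential k η
      let _ := differentialAlgebra_laurentDifferential k η
      IsLiouville F (LaurentSeries F)) :
    IsLiouvilleSubextension F⟮t⟯ := by
  let _ := laurentDifferential k η
  have := differentialAlgebra_laurentDifferential k η
  have hgen : t′ = ((algebraMap F F⟮t⟯ η * AdjoinSimple.gen F t ^ (k + 1) : F⟮t⟯) : L) := hdt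
  have hstable : ∀ u ∈ F⟮t⟯, u′ ∈ F⟮t⟯ := deriv_mem_adjoin fun s hs => by
    rw [Set.mem_singleton_iff.1 hs, hgen]
    exact Subtype.property _
  let _ := subringDifferential F⟮t⟯ hstable
  have := (differentialAlgebra_subringDifferential F⟮t⟯ hstable).1
  obtain ⟨σ, hσ⟩ := exists_algHom_laurentSeries ht
  refine isLiouvilleSubextension_of_algHom σ fun u => ⟨hstable u u.2, ?_⟩
  refine (map_deriv_of_adjoin σ (fun s hs => ?_) u).symm
  obtain rfl : s = t := hs
  have hgen' : (AdjoinSimple.gen F s)′ =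
      algebraMap F F⟮s⟯ η * AdjoinSimple.gen F s ^ (k + 1) := Subtype.ext hgen
  change (σ (AdjoinSimple.gen F s))′ = σ ((AdjoinSimple.gen F s)′)
  rw [hgen', map_mul, map_pow, AlgHom.commutes, hσ, laurentDifferential_deriv_X,
    LaurentSeries.algebraMap_apply]

theorem isLiouvilleSubextension_adjoin_of_exp [CharZero F] {t : L} {a : F}
    (ht : t′ = t * algebraMap F L a′) :
    IsLiouvilleSubextension F⟮t⟯ := by
  by_cases halg : IsAlgebraic F t
  · exact isLiouvilleSubextension_adjoin_of_isAlgebraic halg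
  · exact isLiouvilleSubextension_adjoin_of_laurentDifferential 0 a′ halg
      (by rw [ht, zero_add, pow_one, mul_comm]) (isLiouville_laurentDifferential_zero a)

theorem isLiouvilleSubextension_adjoin_of_log [CharZero F] [ContainConstants F L] {t : L} {a : F}
    (ht : t′ = algebraMap F L (logDeriv a)) : IsLiouvilleSubextension F⟮t⟯ := by
  by_cases halg : IsAlgebraic F t
  · exact isLiouvilleSubextension_adjoin_of_isAlgebraic halg
  have hne (e : F) : e′ ≠ logDeriv a := fun he => by
    obtain ⟨c, hc⟩ := mem_range_of_deriv_eq_zero F (x := t - algebraMap F L e)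
      (by rw [map_sub, ht, deriv_algebraMap, he, sub_self])
    rw [eq_sub_iff_add_eq, ← map_add] at hc
    exact halg (hc ▸ isAlgebraic_algebraMap _)
  have hinv : F⟮t⟯ = F⟮t⁻¹⟯ := by
    refine le_antisymm (adjoin_simple_le_iff.2 ?_) (adjoin_simple_le_iff.2 ?_)
    · simpa only [inv_inv] using inv_mem (mem_adjoin_simple_self F t⁻¹)
    · exact inv_mem (mem_adjoin_simple_self F t)
  rw [hinv]
  refine isLiouvilleSubextension_adjoin_of_laurentDifferential 1 (-logDeriv a)
    (fun h => halg (inv_inv t ▸ h.inv)) ?_ (isLiouville_laurentDifferential_one hne)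
  rw [Derivation.leibniz_inv, ht, smul_eq_mul, map_neg]
  ring

theorem isLiouvilleSubextension_bot : IsLiouvilleSubextension (⊥ : IntermediateField F L) := by
  refine ⟨fun u hu => ?_, fun a ι _ c hc u v hu hv h => ?_⟩
  · obtain ⟨a, rfl⟩ := mem_bot.1 hu
    exact mem_bot.2 ⟨a′, (deriv_algebraMap a).symm⟩
  · choose u₀ hu₀ using fun x => mem_bot.1 (hu x)
    obtain ⟨v₀, rfl⟩ := mem_bot.1 hv
    refine ⟨ι, inferInstance, c, hc, u₀, v₀, (algebraMap F L).injective ?_⟩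
    rw [h, ← funext hu₀, map_add, map_sum, deriv_algebraMap]
    simp only [map_mul, logDeriv_algebraMap]

theorem IsLiouvilleSubextension.restrictScalars [ContainConstants F L]
    {E : IntermediateField F L} (hE : IsLiouvilleSubextension E) {E' : IntermediateField E L}
    (hE' : let _ := subringDifferential E hE.deriv_mem
      IsLiouvilleSubextension E') :
    IsLiouvilleSubextension (E'.restrictScalars F) := by
  let _ := subringDifferential E hE.deriv_mem
  refine ⟨hE'.deriv_mem, fun a ι _ c hc u v hu hv h => ?_⟩
  have hcE (x : ι) : (algebraMap F E (c x))′ = 0 := Subtype.ext <| by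
    change (algebraMap F L (c x))′ = 0
    rw [deriv_algebraMap, hc, map_zero]
  obtain ⟨ι₀, _, c₀, hc₀, u₀, v₀, h₀⟩ := hE'.exists_logForm (algebraMap F E a) ι
    (fun x => algebraMap F E (c x)) hcE u v hu hv h
  have hconst (x : ι₀) : ∃ d : F, algebraMap F L d = c₀ x :=
    mem_range_of_deriv_eq_zero F (congrArg Subtype.val (hc₀ x))
  choose d hd using hconst
  refine hE.exists_logForm a ι₀ d (fun x => ?_) (fun x => u₀ x) v₀ (fun x => (u₀ x).2) v₀.2 ?_
  · refine (algebraMap F L).injective ?_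
    rw [← deriv_algebraMap, hd, map_zero]
    exact congrArg Subtype.val (hc₀ x)
  · have hL := congrArg (algebraMap E L) h₀
    simp only [map_add, map_sum, map_mul] at hL
    simp only [hd]
    exact hL

theorem exists_maximal_isLiouvilleSubextension (F L : Type*) [Field F] [Field L] [Algebra F L]
    [Differential F] [Differential L] [DifferentialAlgebra F L] :
    ∃ E : IntermediateField F L, Maximal IsLiouvilleSubextension E := by
  have hchain (c : Set (IntermediateField F L)) (hc : c ⊆ {E | IsLiouvilleSubextension E})
      (hc' : IsChain (· ≤ ·) c) (E₀ : IntermediateField F L) (hE₀ : E₀ ∈ c) :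
      ∃ E ∈ {E | IsLiouvilleSubextension E}, ∀ E' ∈ c, E' ≤ E := by
    have : Nonempty c := ⟨E₀, hE₀⟩
    exact ⟨⨆ E : c, E, isLiouvilleSubextension_iSup hc'.directedOn.directed_val fun E => hc E.2,
      fun E hE => le_iSup (fun E : c => (E : IntermediateField F L)) ⟨E, hE⟩⟩
  obtain ⟨E, -, hE⟩ := zorn_le_nonempty₀ _ hchain ⊥ isLiouvilleSubextension_bot
  exact ⟨E, hE⟩

section Maximal

variable [ContainConstants F L] {E : IntermediateField F L}
  (hE : Maximal IsLiouvilleSubextension E)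
include hE

theorem mem_of_maximal_isLiouvilleSubextension {t : L}
    (ht : let _ := subringDifferential E hE.prop.deriv_mem
      IsLiouvilleSubextension E⟮t⟯) : t ∈ E :=
  hE.le_of_ge (hE.prop.restrictScalars ht)
    (fun a ha => IntermediateField.algebraMap_mem E⟮t⟯ (⟨a, ha⟩ : E)) (mem_adjoin_simple_self E t)

theorem mem_of_isElementary_of_maximal [CharZero F] {y : L}
    (hy : IsElementary (Set.range (algebraMap F L)) y) : y ∈ E := by
  let _ := subringDifferential E hE.prop.deriv_mem
  have := (differentialAlgebra_subringDifferential E hE.prop.deriv_mem).2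
  have : ContainConstants E L := ⟨fun h =>
    (mem_range_of_deriv_eq_zero F h).imp' (algebraMap F E) fun _ h => h⟩
  induction hy with
  | base h => obtain ⟨a, rfl⟩ := h; exact IntermediateField.algebraMap_mem E a
  | one => exact one_mem E
  | add _ _ ha hb => exact add_mem ha hb
  | sub _ _ ha hb => exact sub_mem ha hb
  | mul _ _ ha hb => exact mul_mem ha hb
  | inv _ h ha => exact eq_inv_of_mul_eq_one_right h ▸ inv_mem ha
  | deriv _ ha => exact hE.prop.deriv_mem _ ha
  | @alg n c b _ h hc =>
    have hb : IsIntegral E b :=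
      ⟨Polynomial.X ^ n + ∑ i : Fin n, Polynomial.C (⟨c i, hc i⟩ : E) * Polynomial.X ^ (i : ℕ),
        Polynomial.monic_X_pow_add (Polynomial.degree_sum_fin_lt _), by
          rw [← h]; simp [Polynomial.eval₂_finsetSum]⟩
    exact mem_of_maximal_isLiouvilleSubextension hE
      (isLiouvilleSubextension_adjoin_of_isAlgebraic hb.isAlgebraic)
  | exp _ _ h ha =>
    exact mem_of_maximal_isLiouvilleSubextension hE
      (isLiouvilleSubextension_adjoin_of_exp (a := ⟨_, ha⟩) h)
  | log _ he h ha =>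
    refine mem_of_maximal_isLiouvilleSubextension hE
      (isLiouvilleSubextension_adjoin_of_log (a := ⟨_, ha⟩) ?_)
    exact (eq_div_iff (left_ne_zero_of_mul_eq_one he)).2 h

end Maximal

theorem hasLogForm_of_isElementary [CharZero F] [ContainConstants F L] {y : L}
    (hy : IsElementary (Set.range (algebraMap F L)) y) {a : F} (ha : y′ = algebraMap F L a) :
    HasLogForm a := by
  obtain ⟨E, hE⟩ := exists_maximal_isLiouvilleSubextension F L
  refine hE.prop.exists_logForm a Empty Empty.elim (fun x => x.elim) Empty.elim y
    (fun x => x.elim) (mem_of_isElementary_of_maximal hE hy) ?_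
  rw [Finset.univ_eq_empty, Finset.sum_empty, zero_add, ha]

end Subextension

section FiniteDescription

variable {R : Type*} [CommRing R] [Differential R]

/-- The closure conditions in `IsElementary` only involve finitely many elements, so that they
already hold in every differential subring that contains these. -/
theorem IsElementary.eventually_subring {S : Set R} {y : R} (hy : IsElementary S y) {σ : Type*}
    [SetLike σ R] [SubringClass σ R] :
    ∀ᶠ T : Finset R in Filter.atTop, ∀ (A : σ) [Differential A],
      (∀ a : A, ((a′ : A) : R) = (a : R)′) → S ⊆ A → (T : Set R) ⊆ A →
        ∃ h : y ∈ A, IsElementary (Subtype.val ⁻¹' S : Set A) ⟨y, h⟩ := by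
  have hmem (b : R) : ∀ᶠ T : Finset R in Filter.atTop, ∀ A : σ, (T : Set R) ⊆ A → b ∈ A := by
    filter_upwards [Filter.eventually_ge_atTop {b}] with T hT A hTA
    exact hTA (Finset.singleton_subset_iff.1 hT)
  induction hy with
  | base h => exact .of_forall fun T A _ _ hS _ => ⟨hS h, base h⟩
  | one => exact .of_forall fun T A _ _ _ _ => ⟨one_mem A, one⟩
  | add _ _ iha ihb =>
    filter_upwards [iha, ihb] with T iha ihb A _ hA hS hT
    exact ⟨_, (iha A hA hS hT).2.add (ihb A hA hS hT).2⟩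
  | sub _ _ iha ihb =>
    filter_upwards [iha, ihb] with T iha ihb A _ hA hS hT
    exact ⟨_, (iha A hA hS hT).2.sub (ihb A hA hS hT).2⟩
  | mul _ _ iha ihb =>
    filter_upwards [iha, ihb] with T iha ihb A _ hA hS hT
    exact ⟨_, (iha A hA hS hT).2.mul (ihb A hA hS hT).2⟩
  | inv _ h ih =>
    filter_upwards [ih, hmem _] with T ih hb A _ hA hS hT
    exact ⟨hb A hT, (ih A hA hS hT).2.inv (Subtype.ext h)⟩
  | deriv _ ih =>
    filter_upwards [ih] with T ih A _ hA hS hT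
    obtain ⟨h, ha⟩ := ih A hA hS hT
    rw [← hA ⟨_, h⟩]
    exact ⟨Subtype.property _, ha.deriv⟩
  | alg _ h ih =>
    filter_upwards [Filter.eventually_all.2 ih, hmem _] with T ih hb A _ hA hS hT
    refine ⟨hb A hT, .alg (fun i => (ih i A hA hS hT).2) (Subtype.ext ?_)⟩
    push_cast
    exact h
  | @exp _ _ e _ he h ih =>
    filter_upwards [ih, hmem _, hmem e] with T ih hb he' A _ hA hS hT
    exact ⟨hb A hT, (ih A hA hS hT).2.exp (e := ⟨e, he' A hT⟩) (Subtype.ext he)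
      (Subtype.ext (by push_cast; rw [hA, hA, h]))⟩
  | @log _ _ e _ he h ih =>
    filter_upwards [ih, hmem _, hmem e] with T ih hb he' A _ hA hS hT
    exact ⟨hb A hT, (ih A hA hS hT).2.log (e := ⟨e, he' A hT⟩) (Subtype.ext he)
      (Subtype.ext (by push_cast; rw [hA, hA, h]))⟩

theorem exists_differential_subalgebra_rank_le_aleph0 {k : Type*} [Field k] [Differential k]
    [Algebra k R] [DifferentialAlgebra k R] {T : Set R} (hT : T.Countable) :
    ∃ A : Subalgebra k R, (∀ a ∈ A, a′ ∈ A) ∧ T ⊆ A ∧ Module.rank k A ≤ Cardinal.aleph0 := by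
  let T' : Set R := ⋃ n : ℕ, (Differential.deriv : Derivation ℤ R R)^[n] '' T
  have hT' : T'.Countable := Set.countable_iUnion fun n => hT.image _
  refine ⟨Algebra.adjoin k T', fun a ha => ?_, fun c hc => ?_, ?_⟩
  · induction ha using Algebra.adjoin_induction with
    | mem x hx =>
      obtain ⟨n, c, hc, rfl⟩ := Set.mem_iUnion.1 hx
      exact Algebra.subset_adjoin
        (Set.mem_iUnion.2 ⟨n + 1, c, hc, Function.iterate_succ_apply' _ n c⟩)
    | algebraMap r => rw [deriv_algebraMap]; exact Subalgebra.algebraMap_mem _ _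
    | add x y _ _ hx hy => rw [map_add]; exact add_mem hx hy
    | mul x y hx hy hx' hy' =>
      rw [Derivation.leibniz]
      exact add_mem (mul_mem hx hy') (mul_mem hy hx')
  · exact Algebra.subset_adjoin (Set.mem_iUnion.2 ⟨0, c, hc, rfl⟩)
  · exact (Algebra.rank_adjoin_le T').trans (max_le hT'.le_aleph0 le_rfl)

end FiniteDescription

section Constants

open Polynomial Differential

variable {k : Type*} [Field k] [Differential k]

section Algebraic

variable {Q : Type*} [Field Q] [Differential Q] [Algebra k Q] [DifferentialAlgebra k Q] {c : Q}

/-- Differentiating `p(c) = 0` shows that the derivatives of the coefficients of the minimal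
polynomial `p` are the coefficients of a polynomial of smaller degree that annihilates `c`. -/
theorem deriv_coeff_minpoly_eq_zero (hc : c′ = 0) (halg : IsAlgebraic k c) (n : ℕ) :
    ((minpoly k c).coeff n)′ = 0 := by
  set p := minpoly k c
  have hmonic : p.Monic := minpoly.monic halg.isIntegral
  have haeval : aeval c (mapCoeffs p) = 0 := by
    have h := deriv_aeval_eq (A := k) (R := Q) c p
    rwa [minpoly.aeval, map_zero, hc, mul_zero, add_zero, eq_comm] at h
  have hdeg : (mapCoeffs p).degree < p.degree := by
    rw [degree_eq_natDegree hmonic.ne_zero, degree_lt_iff_coeff_zero]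
    intro m hm
    rw [coeff_mapCoeffs]
    rcases hm.eq_or_lt with rfl | hm
    · rw [hmonic.coeff_natDegree, Derivation.map_one_eq_zero]
    · rw [coeff_eq_zero_of_natDegree_lt hm, map_zero]
  have hzero : mapCoeffs p = 0 := by
    by_contra hne
    exact hdeg.not_ge (minpoly.degree_le_of_ne_zero k c hne haeval)
  rw [← coeff_mapCoeffs, hzero, coeff_zero]

theorem mem_range_of_isAlgebraic {C : Type*} [Field C] [IsAlgClosed C] [Algebra C k]
    [ContainConstants C k] (hc : c′ = 0) (halg : IsAlgebraic k c) :
    c ∈ (algebraMap k Q).range := by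
  obtain ⟨q, hq⟩ := (lifts_iff_coeff_lifts (minpoly k c)).2 fun n =>
    mem_range_of_deriv_eq_zero C (deriv_coeff_minpoly_eq_zero hc halg n)
  rw [coe_mapRingHom] at hq
  have hirr := minpoly.irreducible halg.isIntegral
  obtain ⟨z, hz⟩ := IsAlgClosed.exists_root q
    (degree_map q (algebraMap C k) ▸ hq ▸ (degree_pos_of_irreducible hirr).ne')
  exact minpoly.mem_range_of_degree_eq_one k c
    (degree_eq_one_of_irreducible_of_root hirr (hq ▸ hz.map))

end Algebraic

theorem IsDifferentialSimple.isUnit_of_deriv_eq_zero {R : Type*} [CommRing R] [Differential R]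
    (hR : IsDifferentialSimple R) {a : R} (ha : a ≠ 0) (ha' : a′ = 0) : IsUnit a := by
  refine Ideal.span_singleton_eq_top.1 ((hR (Ideal.span {a}) fun b hb => ?_).resolve_left
    (Ideal.span_singleton_eq_bot.not.2 ha))
  obtain ⟨r, rfl⟩ := Ideal.mem_span_singleton'.1 hb
  rw [Derivation.leibniz, ha', smul_zero, zero_add]
  exact Ideal.mul_mem_right _ _ (Ideal.mem_span_singleton_self a)

/-- The denominators of a constant of the fraction field form a differential ideal. -/
theorem IsDifferentialSimple.mem_range_of_deriv_eq_zero {S Q : Type*} [CommRing S] [IsDomain S]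
    [Differential S] [Field Q] [Differential Q] [Algebra S Q] [DifferentialAlgebra S Q]
    [IsFractionRing S Q] (hS : IsDifferentialSimple S) {c : Q} (hc : c′ = 0) :
    c ∈ (algebraMap S Q).range := by
  let I : Ideal S := (1 : Submodule S Q).colon {c}
  have hI {a : S} : a ∈ I ↔ ∃ r, algebraMap S Q r = algebraMap S Q a * c := by
    rw [Submodule.mem_colon_singleton, Submodule.mem_one, Algebra.smul_def]
  have hI' (a : S) (ha : a ∈ I) : a′ ∈ I := by
    obtain ⟨r, hr⟩ := hI.1 ha
    refine hI.2 ⟨r′, ?_⟩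
    rw [← deriv_algebraMap, hr, Derivation.leibniz, hc, smul_zero, zero_add, smul_eq_mul, mul_comm,
      deriv_algebraMap]
  obtain ⟨a, b, hb, rfl⟩ := IsFractionRing.div_surjective (A := S) c
  have hb₀ : b ≠ 0 := nonZeroDivisors.ne_zero hb
  have hbI : b ∈ I := hI.2 ⟨a, (mul_div_cancel₀ _
    ((map_ne_zero_iff _ (IsFractionRing.injective S Q)).2 hb₀)).symm⟩
  have htop : I = ⊤ := (hS I hI').resolve_left fun h => hb₀ (by rwa [h] at hbI)
  obtain ⟨r, hr⟩ := hI.1 ((Ideal.eq_top_iff_one I).1 htop)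
  exact ⟨r, by rw [hr, map_one, one_mul]⟩

/-- A transcendental constant `c` would give the linearly independent family of the `(c - z)⁻¹`,
where `z` runs through the constants of `k`. -/
theorem IsDifferentialSimple.isAlgebraic_of_deriv_eq_zero {C S : Type u} {Q : Type*} [Field C]
    [Algebra C k] (hC : ∀ z : C, (algebraMap C k z)′ = 0) [CommRing S] [IsDomain S] [Differential S]
    [Algebra k S] [DifferentialAlgebra k S] [Field Q] [Differential Q] [Algebra S Q] [Algebra k Q]
    [IsScalarTower k S Q] [DifferentialAlgebra S Q] [IsFractionRing S Q]
    (hS : IsDifferentialSimple S) (hrank : Module.rank k S < Cardinal.mk C) {c : Q}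
    (hc : c′ = 0) : IsAlgebraic k c := by
  obtain ⟨s, rfl⟩ := hS.mem_range_of_deriv_eq_zero hc
  by_contra htr
  have hs : s′ = 0 := IsFractionRing.injective S Q (by rw [← deriv_algebraMap, hc, map_zero])
  have hne (z : C) : s - algebraMap k S (algebraMap C k z) ≠ 0 := by
    rw [sub_ne_zero]
    rintro rfl
    rw [← IsScalarTower.algebraMap_apply] at htr
    exact htr (isAlgebraic_algebraMap _)
  have hunit (z : C) : IsUnit (s - algebraMap k S (algebraMap C k z)) :=
    hS.isUnit_of_deriv_eq_zero (hne z) (by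
      rw [map_sub, hs, deriv_algebraMap, hC, map_zero, sub_zero])
  choose r hr using hunit
  have hli : LinearIndependent k fun z : C => ((r z)⁻¹ : Sˣ).val := by
    refine LinearIndependent.of_comp (IsScalarTower.toAlgHom k S Q).toLinearMap ?_
    convert (Transcendental.linearIndependent_sub_inv htr).comp _ (algebraMap C k).injective using 1
    funext z
    refine eq_inv_of_mul_eq_one_left ?_
    rw [IsScalarTower.algebraMap_apply k S Q, ← map_sub, Function.comp_apply, ← hr z]
    exact (map_mul (algebraMap S Q) _ _).symm.trans (by rw [Units.inv_mul, map_one])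
  exact hrank.not_ge hli.cardinal_le_rank

theorem IsDifferentialSimple.containConstants {C S : Type u} {Q : Type*} [Field C] [IsAlgClosed C]
    [Algebra C k] [ContainConstants C k] (hC : ∀ z : C, (algebraMap C k z)′ = 0) [CommRing S]
    [IsDomain S] [Differential S] [Algebra k S] [DifferentialAlgebra k S] [Field Q] [Differential Q]
    [Algebra S Q] [Algebra k Q] [IsScalarTower k S Q] [DifferentialAlgebra S Q]
    [DifferentialAlgebra k Q] [IsFractionRing S Q] (hS : IsDifferentialSimple S)
    (hrank : Module.rank k S < Cardinal.mk C) : ContainConstants k Q :=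
  ⟨fun hc => mem_range_of_isAlgebraic (C := C) hc (hS.isAlgebraic_of_deriv_eq_zero hC hrank hc)⟩

end Constants

section Primitive

variable {C k : Type u} [Field C] [IsAlgClosed C] [Field k] [CharZero k] [Differential k]
  [Algebra C k] [Differential.ContainConstants C k]

theorem hasLogForm_of_isElementary_of_rank_lt (hC : ∀ z : C, (algebraMap C k z)′ = 0) {A : Type u}
    [CommRing A] [Nontrivial A] [Differential A] [Algebra k A] [DifferentialAlgebra k A]
    (hrank : Module.rank k A < Cardinal.mk C) {y : A}
    (hy : IsElementary (Set.range (algebraMap k A)) y) {f : k} (hf : y′ = algebraMap k A f) :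
    HasLogForm f := by
  obtain ⟨I, hI, hI', hsimple⟩ := exists_quotient_isDifferentialSimple A
  let _ := quotientDifferential I hI
  have : Nontrivial (A ⧸ I) := Ideal.Quotient.nontrivial_iff.2 hI'
  let _ : Algebra ℚ (A ⧸ I) := ((algebraMap k (A ⧸ I)).comp (algebraMap ℚ k)).toAlgebra
  have : IsDomain (A ⧸ I) := hsimple.isDomain
  let Q := FractionRing (A ⧸ I)
  let _ := fractionDifferential (A ⧸ I) Q
  have : DifferentialAlgebra (A ⧸ I) Q := ⟨fractionDifferential_deriv_algebraMap (A ⧸ I) Q⟩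
  have : DifferentialAlgebra k (A ⧸ I) :=
    ⟨fun a => (quotientDifferential_deriv_mk I hI _).trans
      (congrArg (Ideal.Quotient.mk I) (deriv_algebraMap a))⟩
  have : DifferentialAlgebra k Q :=
    ⟨fun a => by
      rw [IsScalarTower.algebraMap_apply k (A ⧸ I) Q, deriv_algebraMap, deriv_algebraMap,
        ← IsScalarTower.algebraMap_apply]⟩
  have hrank' : Module.rank k (A ⧸ I) < Cardinal.mk C :=
    (LinearMap.rank_le_of_surjective (Ideal.Quotient.mkₐ k I).toLinearMap
      Ideal.Quotient.mk_surjective).trans_lt hrank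
  have : Differential.ContainConstants k Q := hsimple.containConstants hC hrank'
  let π : A →+* Q := (algebraMap (A ⧸ I) Q).comp (Ideal.Quotient.mk I)
  have hπ (a : A) : (π a)′ = π a′ := by
    rw [RingHom.comp_apply, deriv_algebraMap, quotientDifferential_deriv_mk, RingHom.comp_apply]
  have hπk (a : k) : π (algebraMap k A a) = algebraMap k Q a := rfl
  have hπy : IsElementary (Set.range (algebraMap k Q)) (π y) :=
    hy.map π hπ (by rintro _ ⟨a, rfl⟩; exact .base ⟨a, (hπk a).symm⟩)
  exact hasLogForm_of_isElementary hπy (by rw [hπ, hf, hπk])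

/-- **Liouville's theorem** in a differential ring. The elementary element lies in a subalgebra of
countable rank. -/
theorem hasLogForm_of_isElementary_of_aleph0_lt (hC : ∀ z : C, (algebraMap C k z)′ = 0)
    (hcard : Cardinal.aleph0 < Cardinal.mk C) {L : Type u} [CommRing L] [Nontrivial L]
    [Differential L] [Algebra k L] [DifferentialAlgebra k L] {y : L}
    (hy : IsElementary (Set.range (algebraMap k L)) y) {f : k} (hf : y′ = algebraMap k L f) :
    HasLogForm f := by
  obtain ⟨T, hT⟩ := (hy.eventually_subring (σ := Subalgebra k L)).exists
  obtain ⟨A, hA, hTA, hrank⟩ :=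
    exists_differential_subalgebra_rank_le_aleph0 (k := k) T.countable_toSet
  let _ := subringDifferential A hA
  have : DifferentialAlgebra k A := ⟨fun a => Subtype.ext (deriv_algebraMap (B := L) a)⟩
  obtain ⟨hyA, hyE⟩ := hT A (fun _ => rfl)
    (Set.range_subset_iff.2 fun a => A.algebraMap_mem a) hTA
  have hpre : (Subtype.val ⁻¹' Set.range (algebraMap k L) : Set A) = Set.range (algebraMap k A) :=
    Set.ext fun a => exists_congr fun b => (Subtype.ext_iff (a1 := algebraMap k A b) (a2 := a)).symm
  rw [hpre] at hyE
  exact hasLogForm_of_isElementary_of_rank_lt hC (hrank.trans_lt hcard) hyE (Subtype.ext hf)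

end Primitive

theorem isPreconnected_punctured_ball (z : ℂ) {r : ℝ} (hr : 0 < r) :
    IsPreconnected (Metric.ball z r \ {z}) := by
  have himage : (fun w => z + Complex.exp w) '' {w | w.re < Real.log r} =
      Metric.ball z r \ {z} := by
    ext v
    simp only [Set.mem_image, Set.mem_ofPred_eq, Set.mem_sdiff, Metric.mem_ball,
      Set.mem_singleton_iff, dist_eq_norm]
    constructor
    · rintro ⟨w, hw, rfl⟩
      rw [add_sub_cancel_left, Complex.norm_exp]
      exact ⟨(Real.lt_log_iff_exp_lt hr).1 hw, by simp⟩
    · rintro ⟨hlt, hne⟩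
      have hne' : v - z ≠ 0 := sub_ne_zero.2 hne
      refine ⟨Complex.log (v - z), ?_, by rw [Complex.exp_log hne', add_sub_cancel]⟩
      rw [Complex.log_re]
      exact Real.log_lt_log (norm_pos_iff.2 hne') hlt
  rw [← himage]
  exact (convex_halfSpace_re_lt _).isPreconnected.image _ (by fun_prop)

theorem eventually_const_of_deriv_eq_zero {f : ℂ → ℂ} {z : ℂ} (hf : MeromorphicAt f z)
    (h : ∀ᶠ w in 𝓝[≠] z, deriv f w = 0) : ∃ c, f =ᶠ[𝓝[≠] z] fun _ => c := by
  obtain ⟨r, hr, hball⟩ := Metric.eventually_nhds_iff_ball.1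
    (eventually_nhdsWithin_iff.1 (h.and hf.eventually_analyticAt))
  obtain ⟨c, hc⟩ := (Metric.isOpen_ball.sdiff isClosed_singleton).exists_is_const_of_deriv_eq_zero
    (isPreconnected_punctured_ball z hr)
    (fun w hw => (hball w hw.1 hw.2).2.differentiableAt.differentiableWithinAt)
    (fun w hw => (hball w hw.1 hw.2).1)
  exact ⟨c, mem_of_superset (sdiff_mem_nhdsWithin_compl (Metric.ball_mem_nhds z hr) {z}) hc⟩

section GermField

/-- The ring of germs at `z` of meromorphic functions. The value at `z` is disregarded. -/
def meromorphicGerms (z : ℂ) : Subring (Germ (𝓝[≠] z) ℂ) where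
  carrier := {a | ∃ f : ℂ → ℂ, MeromorphicAt f z ∧ (f : Germ (𝓝[≠] z) ℂ) = a}
  zero_mem' := ⟨0, .const 0 z, rfl⟩
  one_mem' := ⟨1, .const 1 z, rfl⟩
  add_mem' := by
    rintro _ _ ⟨f, hf, rfl⟩ ⟨g, hg, rfl⟩
    exact ⟨f + g, hf.add hg, rfl⟩
  mul_mem' := by
    rintro _ _ ⟨f, hf, rfl⟩ ⟨g, hg, rfl⟩
    exact ⟨f * g, hf.mul hg, rfl⟩
  neg_mem' := by
    rintro _ ⟨f, hf, rfl⟩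
    exact ⟨-f, hf.neg, rfl⟩

variable {X : ℂ → ℂ} {z : ℂ}

/-- The field of germs at `z` of meromorphic functions, with the derivation `d / dX`. The function
`X` is part of the type so that the derivation can be an instance. -/
def GermField (_hX : MeromorphicAt X z) : Type := meromorphicGerms z

variable (hX : MeromorphicAt X z)

instance : CommRing (GermField hX) := inferInstanceAs (CommRing (meromorphicGerms z))

/-- The germ of a function that is meromorphic at `z`. -/
def germ {f : ℂ → ℂ} (hf : MeromorphicAt f z) : GermField hX := ⟨f, f, hf, rfl⟩

variable {f g : ℂ → ℂ} (hf : MeromorphicAt f z) (hg : MeromorphicAt g z)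

variable {hX} in
theorem exists_germ_eq (a : GermField hX) : ∃ (f : ℂ → ℂ) (hf : MeromorphicAt f z),
    germ hX hf = a := by
  obtain ⟨_, f, hf, rfl⟩ := a
  exact ⟨f, hf, rfl⟩

variable {hf hg} in
theorem germ_eq_germ_iff : germ hX hf = germ hX hg ↔ f =ᶠ[𝓝[≠] z] g :=
  Subtype.ext_iff.trans Germ.coe_eq

variable {hf} in
theorem germ_eq_zero_iff : germ hX hf = 0 ↔ ∀ᶠ w in 𝓝[≠] z, f w = 0 :=
  germ_eq_germ_iff hX (hg := .const 0 z)

theorem germ_add : germ hX (hf.fun_add hg) = germ hX hf + germ hX hg := rfl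

theorem germ_sub : germ hX (hf.fun_sub hg) = germ hX hf - germ hX hg :=
  Subtype.ext rfl

theorem germ_mul : germ hX (hf.fun_mul hg) = germ hX hf * germ hX hg := rfl

theorem germ_pow (n : ℕ) : germ hX (hf.fun_pow n) = germ hX hf ^ n := Subtype.ext rfl

instance : Field (GermField hX) where
  inv a := ⟨a.1⁻¹, by
    obtain ⟨_, f, hf, rfl⟩ := a
    exact ⟨f⁻¹, hf.inv, rfl⟩⟩
  exists_pair_ne := ⟨1, 0, fun h =>
    one_ne_zero ((germ_eq_zero_iff hX (hf := .const 1 z)).1 h).exists.choose_spec⟩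
  mul_inv_cancel a ha := by
    obtain ⟨f, hf, rfl⟩ := exists_germ_eq a
    rw [Ne, germ_eq_zero_iff] at ha
    refine (germ_eq_germ_iff hX (hf := hf.mul hf.inv) (hg := .const 1 z)).2 ?_
    filter_upwards [hf.eventually_eq_zero_or_eventually_ne_zero.resolve_left ha] with w hw
    exact mul_inv_cancel₀ hw
  inv_zero := (germ_eq_germ_iff hX (hf := .inv (.const 0 z)) (hg := .const 0 z)).2
    (.of_forall fun _ => inv_zero)
  nnqsmul := _
  nnqsmul_def _ _ := rfl
  qsmul := _
  qsmul_def _ _ := rfl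

theorem germ_div : germ hX (hf.fun_div hg) = germ hX hf / germ hX hg := rfl

theorem germ_sum {ι : Type*} (s : Finset ι) {f : ι → ℂ → ℂ} (hf : ∀ i, MeromorphicAt (f i) z) :
    germ hX (MeromorphicAt.fun_sum fun i (_ : i ∈ s) => hf i) = ∑ i ∈ s, germ hX (hf i) := by
  induction s using Finset.cons_induction with
  | empty => rfl
  | cons i s hi ih =>
    rw [Finset.sum_cons, ← ih, ← germ_add, germ_eq_germ_iff]
    exact .of_forall fun w => Finset.sum_cons hi

instance : Algebra ℂ (GermField hX) := RingHom.toAlgebra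
  { toFun c := germ hX (.const c z)
    map_one' := rfl
    map_mul' _ _ := rfl
    map_zero' := rfl
    map_add' _ _ := rfl }

instance : Differential (GermField hX) :=
  differentialOfLeibniz
    (AddMonoidHom.mk' (fun a => ⟨a.1.map' (fun f w => deriv f w / deriv X w) fun f g h => by
        filter_upwards [h.nhdsNE_deriv] with w hw
        rw [hw], by
      obtain ⟨_, f, hf, rfl⟩ := a
      exact ⟨_, hf.deriv.fun_div hX.deriv, rfl⟩⟩) fun a b => by
        obtain ⟨f, hf, rfl⟩ := exists_germ_eq a
        obtain ⟨g, hg, rfl⟩ := exists_germ_eq b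
        refine (germ_eq_germ_iff hX (hf := (hf.add hg).deriv.fun_div hX.deriv)
          (hg := (hf.deriv.fun_div hX.deriv).fun_add (hg.deriv.fun_div hX.deriv))).2 ?_
        filter_upwards [hf.eventually_analyticAt, hg.eventually_analyticAt] with w hfw hgw
        rw [deriv_add hfw.differentiableAt hgw.differentiableAt, add_div])
    fun a b => by
      obtain ⟨f, hf, rfl⟩ := exists_germ_eq a
      obtain ⟨g, hg, rfl⟩ := exists_germ_eq b
      refine (germ_eq_germ_iff hX (hf := (hf.mul hg).deriv.fun_div hX.deriv)
        (hg := (hf.fun_mul (hg.deriv.fun_div hX.deriv)).fun_add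
          (hg.fun_mul (hf.deriv.fun_div hX.deriv)))).2 ?_
      filter_upwards [hf.eventually_analyticAt, hg.eventually_analyticAt] with w hfw hgw
      rw [deriv_mul hfw.differentiableAt hgw.differentiableAt]
      ring

theorem deriv_germ : (germ hX hf)′ = germ hX (hf.deriv.fun_div hX.deriv) := rfl

theorem deriv_algebraMap_complex (c : ℂ) : (algebraMap ℂ (GermField hX) c)′ = 0 :=
  (germ_eq_zero_iff hX (hf := (MeromorphicAt.const c z).deriv.fun_div hX.deriv)).2
    (.of_forall fun w => by rw [deriv_const, zero_div])

theorem germ_deriv_ne_zero (hf : MeromorphicAt f z)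
    (hconst : ¬ ∃ c, f =ᶠ[𝓝[≠] z] fun _ => c) : germ hX hf.deriv ≠ 0 := fun h =>
  hconst (eventually_const_of_deriv_eq_zero hf ((germ_eq_zero_iff hX).1 h))

theorem containConstants_germField (hconst : ¬ ∃ c, X =ᶠ[𝓝[≠] z] fun _ => c) :
    Differential.ContainConstants ℂ (GermField hX) where
  mem_range_of_deriv_eq_zero {a} ha := by
    obtain ⟨f, hf, rfl⟩ := exists_germ_eq a
    rw [deriv_germ, germ_div hX hf.deriv hX.deriv,
      div_eq_zero_iff, or_iff_left (germ_deriv_ne_zero hX hX hconst), germ_eq_zero_iff] at ha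
    obtain ⟨c, hc⟩ := eventually_const_of_deriv_eq_zero hf ha
    exact ⟨c, ((germ_eq_germ_iff hX (hg := .const c z)).2 hc).symm⟩

end GermField

section Pullback

variable {X F : ℂ → ℂ} {z : ℂ} (hX : MeromorphicAt X z) (hF : AnalyticAt ℂ F z)
  (hFz : Tendsto F (𝓝[≠] z) (𝓝[≠] (F z)))

/-- Composition of germs at `F z` with the analytic function `F`. -/
def germPullback {Y : ℂ → ℂ} (hY : MeromorphicAt Y (F z)) : GermField hY →+* GermField hX where
  toFun a := ⟨a.1.compTendsto F hFz, by
    obtain ⟨_, g, hg, rfl⟩ := a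
    exact ⟨g ∘ F, hg.comp_analyticAt hF, rfl⟩⟩
  map_zero' := rfl
  map_one' := rfl
  map_add' := by
    rintro ⟨_, f, hf, rfl⟩ ⟨_, g, hg, rfl⟩
    rfl
  map_mul' := by
    rintro ⟨_, f, hf, rfl⟩ ⟨_, g, hg, rfl⟩
    rfl

theorem deriv_germPullback (a : GermField (MeromorphicAt.id (F z))) :
    (germPullback hX hF hFz _ a)′ =
      (germ hX hF.meromorphicAt)′ * germPullback hX hF hFz _ a′ := by
  obtain ⟨g, hg, rfl⟩ := exists_germ_eq a
  refine (germ_eq_germ_iff hX (hf := (hg.comp_analyticAt hF).deriv.fun_div hX.deriv)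
    (hg := (hF.meromorphicAt.deriv.fun_div hX.deriv).fun_mul
      ((hg.deriv.fun_div (MeromorphicAt.id _).deriv).comp_analyticAt hF))).2 ?_
  filter_upwards [hFz.eventually hg.eventually_analyticAt,
    hF.eventually_analyticAt.filter_mono nhdsWithin_le_nhds] with w hgw hFw
  rw [Function.comp_apply, deriv_comp w hgw.differentiableAt hFw.differentiableAt, deriv_id]
  ring

end Pullback

section Charts

variable {U : Type*} [TopologicalSpace U] [ChartedSpace ℂ U] {x f g : U → ℂ} {p q u : U}

/-- Meromorphy of a function on a surface at a single point. -/
abbrev MerAt (f : U → ℂ) (p : U) : Prop := MeromorphicAt (inChart f p) (chartAt ℂ p p)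

/-- The change of coordinates from the preferred chart at `q` to the one at `p`. -/
def transition (q p : U) : ℂ → ℂ := chartAt ℂ p ∘ (chartAt ℂ q).symm

theorem eventually_mem_chart_source (p : U) : ∀ᶠ u in 𝓝 p, u ∈ (chartAt ℂ p).source :=
  (chartAt ℂ p).open_source.mem_nhds (mem_chart_source ℂ p)

theorem eventually_mem_chart_target (p : U) :
    ∀ᶠ w in 𝓝 (chartAt ℂ p p), w ∈ (chartAt ℂ p).target :=
  (chartAt ℂ p).open_target.mem_nhds (mem_chart_target ℂ p)

theorem continuousAt_chart (p : U) : ContinuousAt (chartAt ℂ p) p :=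
  (chartAt ℂ p).continuousAt (mem_chart_source ℂ p)

theorem tendsto_chart_nhdsNE (p : U) :
    Tendsto (chartAt ℂ p) (𝓝[≠] p) (𝓝[≠] (chartAt ℂ p p)) :=
  tendsto_nhdsWithin_iff.2 ⟨(continuousAt_chart p).mono_left nhdsWithin_le_nhds,
    (chartAt ℂ p).eventually_ne_nhdsWithin (mem_chart_source ℂ p)⟩

theorem eventually_nhds_chart {P : U → Prop} :
    (∀ᶠ w in 𝓝 (chartAt ℂ p p), P ((chartAt ℂ p).symm w)) ↔ ∀ᶠ u in 𝓝 p, P u :=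
  (chartAt ℂ p).eventually_nhds' P (mem_chart_source ℂ p)

theorem eventually_nhdsNE_chart {P : U → Prop} :
    (∀ᶠ w in 𝓝[≠] (chartAt ℂ p p), P ((chartAt ℂ p).symm w)) ↔ ∀ᶠ u in 𝓝[≠] p, P u := by
  rw [eventually_nhdsWithin_iff, eventually_nhdsWithin_iff,
    ← (chartAt ℂ p).eventually_nhds' _ (mem_chart_source ℂ p)]
  refine eventually_congr ?_
  filter_upwards [eventually_mem_chart_target p] with w hw
  rw [Set.mem_compl_singleton_iff, Set.mem_compl_singleton_iff, ne_comm,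
    ne_comm (b := p), Ne, Ne, (chartAt ℂ p).eq_symm_apply (mem_chart_source ℂ p) hw]

instance neBot_nhdsNE (p : U) : (𝓝[≠] p).NeBot :=
  frequently_true_iff_neBot _ |>.1 fun h => (eventually_nhdsNE_chart.2 h).exists.elim
    fun _ hw => hw trivial

theorem inChart_self (f : U → ℂ) (p : U) : inChart f p (chartAt ℂ p p) = f p :=
  congrArg f ((chartAt ℂ p).left_inv (mem_chart_source ℂ p))

theorem holAt_merAt (h : HolAt f p) : MerAt f p := AnalyticAt.meromorphicAt h

theorem holAt_congr (h : HolAt f p) (hfg : f =ᶠ[𝓝 p] g) : HolAt g p :=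
  AnalyticAt.congr h (eventually_nhds_chart.2 hfg)

theorem continuousAt_of_holAt (h : HolAt f p) : ContinuousAt f p := by
  refine ((AnalyticAt.continuousAt h).comp (continuousAt_chart p)).congr ?_
  filter_upwards [eventually_mem_chart_source p] with u hu
  exact congrArg f ((chartAt ℂ p).left_inv hu)

theorem transition_apply (hq : u ∈ (chartAt ℂ q).source) :
    transition q p (chartAt ℂ q u) = chartAt ℂ p u :=
  congrArg (chartAt ℂ p) ((chartAt ℂ q).left_inv hq)

theorem inChart_eventuallyEq (f : U → ℂ) (hp : u ∈ (chartAt ℂ p).source)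
    (hq : u ∈ (chartAt ℂ q).source) :
    inChart f q =ᶠ[𝓝 (chartAt ℂ q u)] inChart f p ∘ transition q p := by
  filter_upwards [((chartAt ℂ q).eventually_nhds' _ hq).2
    ((chartAt ℂ p).open_source.mem_nhds hp)] with w hw
  exact congrArg f ((chartAt ℂ p).left_inv hw).symm

theorem transition_transition_eventuallyEq (hp : u ∈ (chartAt ℂ p).source)
    (hq : u ∈ (chartAt ℂ q).source) :
    transition p q ∘ transition q p =ᶠ[𝓝 (chartAt ℂ q u)] id := by
  filter_upwards [((chartAt ℂ q).eventually_nhds' _ hq).2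
    ((chartAt ℂ p).open_source.mem_nhds hp),
    (chartAt ℂ q).open_target.mem_nhds ((chartAt ℂ q).map_source hq)] with w hw hwq
  exact (congrArg (chartAt ℂ q) ((chartAt ℂ p).left_inv hw)).trans ((chartAt ℂ q).right_inv hwq)

theorem eventually_eq_zero_or_of_merAt (h : MerAt f p) :
    (∀ᶠ u in 𝓝[≠] p, f u = 0) ∨ ∀ᶠ u in 𝓝[≠] p, f u ≠ 0 :=
  (MeromorphicAt.eventually_eq_zero_or_eventually_ne_zero h).imp
    eventually_nhdsNE_chart.1 eventually_nhdsNE_chart.1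

theorem eventually_eq_zero_of_isPreconnected [T1Space U] {W : Set U} (hW : IsPreconnected W)
    (hf : ∀ w ∈ W, MerAt f w) (hp : p ∈ W) (hq : q ∈ W) (h : ∀ᶠ u in 𝓝[≠] p, f u = 0) :
    ∀ᶠ u in 𝓝[≠] q, f u = 0 := by
  by_contra hne
  obtain ⟨r, -, hr, hr'⟩ := hW {r | ∀ᶠ u in 𝓝[≠] r, f u = 0} {r | ∀ᶠ u in 𝓝[≠] r, f u ≠ 0}
    isOpen_setOfPred_eventually_nhdsWithin isOpen_setOfPred_eventually_nhdsWithin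
    (fun w hw => eventually_eq_zero_or_of_merAt (hf w hw)) ⟨p, hp, h⟩
    ⟨q, hq, (eventually_eq_zero_or_of_merAt (hf q hq)).resolve_left hne⟩
  rw [Set.mem_ofPred_eq] at hr hr'
  obtain ⟨v, hv, hv'⟩ := (hr.and hr').exists
  exact hv' hv

variable [IsManifold 𝓘(ℂ) ω U]

theorem analyticAt_transition (hp : u ∈ (chartAt ℂ p).source)
    (hq : u ∈ (chartAt ℂ q).source) : AnalyticAt ℂ (transition q p) (chartAt ℂ q u) := by
  have hu : chartAt ℂ q u ∈ ((chartAt ℂ q).symm.trans (chartAt ℂ p)).source := by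
    simp [hp, hq]
  have hsmooth := contDiffOn_ext_coord_change (I := 𝓘(ℂ)) (n := ω) p q
  simp only [mfld_simps] at hsmooth hu
  exact (hsmooth.contDiffAt ((((chartAt ℂ q).symm.trans (chartAt ℂ p)).open_source.mem_nhds
    hu))).analyticAt

theorem deriv_transition_ne_zero (hp : u ∈ (chartAt ℂ p).source)
    (hq : u ∈ (chartAt ℂ q).source) : deriv (transition q p) (chartAt ℂ q u) ≠ 0 := by
  have hd := (analyticAt_transition hq hp).differentiableAt
  rw [← transition_apply hq] at hd
  have hmul := (transition_transition_eventuallyEq hp hq).deriv_eq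
  rw [deriv_comp _ hd (analyticAt_transition hp hq).differentiableAt, deriv_id] at hmul
  exact right_ne_zero_of_mul_eq_one hmul

theorem holAt_iff (hq : q ∈ (chartAt ℂ p).source) :
    HolAt f q ↔ AnalyticAt ℂ (inChart f p) (chartAt ℂ p q) := by
  have hqq := mem_chart_source ℂ q
  constructor
  · intro h
    rw [analyticAt_congr (inChart_eventuallyEq f hqq hq)]
    exact AnalyticAt.comp_of_eq h (analyticAt_transition hqq hq) (transition_apply hq)
  · intro h
    rw [HolAt, analyticAt_congr (inChart_eventuallyEq f hq hqq)]
    exact h.comp_of_eq (analyticAt_transition hq hqq) (transition_apply hqq)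

theorem eventually_holAt_of_holAt (h : HolAt f p) : ∀ᶠ u in 𝓝 p, HolAt f u := by
  filter_upwards [(continuousAt_chart p).eventually (AnalyticAt.eventually_analyticAt h),
    eventually_mem_chart_source p] with u hu hup
  exact (holAt_iff hup).2 hu

theorem eventually_holAt_of_merAt (h : MerAt f p) : ∀ᶠ u in 𝓝[≠] p, HolAt f u := by
  filter_upwards [(tendsto_chart_nhdsNE p).eventually h.eventually_analyticAt,
    (eventually_mem_chart_source p).filter_mono nhdsWithin_le_nhds] with u hu hup
  exact (holAt_iff hup).2 hu

theorem chartDeriv_eq (hq : q ∈ (chartAt ℂ p).source)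
    (hf : AnalyticAt ℂ (inChart f p) (chartAt ℂ p q)) :
    chartDeriv f q = deriv (inChart f p) (chartAt ℂ p q) *
      deriv (transition q p) (chartAt ℂ q q) := by
  have hqq := mem_chart_source ℂ q
  have hf' := hf.differentiableAt
  rw [← transition_apply hqq] at hf' ⊢
  rw [chartDeriv, (inChart_eventuallyEq f hq hqq).deriv_eq,
    deriv_comp _ hf' (analyticAt_transition hq hqq).differentiableAt]

theorem inChart_derivWrt {w : ℂ} (hw : w ∈ (chartAt ℂ p).target)
    (hx : AnalyticAt ℂ (inChart x p) w) (hf : AnalyticAt ℂ (inChart f p) w) :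
    inChart (derivWrt x f) p w = deriv (inChart f p) w / deriv (inChart x p) w := by
  obtain ⟨q, hq, rfl⟩ : ∃ q ∈ (chartAt ℂ p).source, chartAt ℂ p q = w :=
    ⟨_, (chartAt ℂ p).map_target hw, (chartAt ℂ p).right_inv hw⟩
  rw [inChart, Function.comp_apply, (chartAt ℂ p).left_inv hq, derivWrt, chartDeriv_eq hq hf,
    chartDeriv_eq hq hx,
    mul_div_mul_right _ _ (deriv_transition_ne_zero hq (mem_chart_source ℂ q))]

theorem inChart_derivWrt_eventuallyEq (hx : MerAt x p) (hf : MerAt f p) :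
    inChart (derivWrt x f) p =ᶠ[𝓝[≠] (chartAt ℂ p p)]
      fun w => deriv (inChart f p) w / deriv (inChart x p) w := by
  filter_upwards [(eventually_mem_chart_target p).filter_mono nhdsWithin_le_nhds,
    hx.eventually_analyticAt, hf.eventually_analyticAt] with w hw hxw hfw
  exact inChart_derivWrt hw hxw hfw

theorem merAt_derivWrt (hx : MerAt x p) (hf : MerAt f p) : MerAt (derivWrt x f) p :=
  (hf.deriv.fun_div hx.deriv).congr (inChart_derivWrt_eventuallyEq hx hf).symm

theorem holAt_derivWrt (hx : HolAt x p) (hf : HolAt f p) (h : chartDeriv x p ≠ 0) :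
    HolAt (derivWrt x f) p := by
  refine ((AnalyticAt.deriv hf).fun_div (AnalyticAt.deriv hx) h).congr ?_
  filter_upwards [eventually_mem_chart_target p, AnalyticAt.eventually_analyticAt hx,
    AnalyticAt.eventually_analyticAt hf] with w hw hxw hfw
  exact (inChart_derivWrt hw hxw hfw).symm

end Charts

section ElementaryGerm

variable {U : Type*} [TopologicalSpace U] [ChartedSpace ℂ U] {x f g : U → ℂ} {p q : U}
  {B : Set (U → ℂ)}

/-- The germs at `p` of the functions in `B` that are meromorphic at `p`. -/
def germsOf (hx : MerAt x p) (B : Set (U → ℂ)) : Set (GermField hx) :=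
  {a | ∃ f ∈ B, ∃ hf : MerAt f p, germ hx hf = a}

/-- The germ of `f` at `p` is holomorphic, and elementary over the germs of the functions in `B`
inside some differential extension of the field of meromorphic germs at `p`. The extension is
needed because an algebraic operation may be applied to a germ that arises only after analytic
continuation. -/
structure IsElementaryGerm (x : U → ℂ) (B : Set (U → ℂ)) (f : U → ℂ) (p : U) : Prop where
  merAt : MerAt x p
  holAt : HolAt f p
  isElementaryInExtension :
    IsElementaryInExtension (germsOf merAt B) (germ merAt (holAt_merAt holAt))

theorem germ_congr (hx : MerAt x p) (hf : MerAt f p) (hg : MerAt g p) (h : f =ᶠ[𝓝 p] g) :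
    germ hx hf = germ hx hg :=
  (germ_eq_germ_iff hx).2 (eventually_nhdsNE_chart.2 (h.filter_mono nhdsWithin_le_nhds))

namespace IsElementaryGerm

theorem of_mem (hx : MerAt x p) (hf : f ∈ B) (hp : HolAt f p) : IsElementaryGerm x B f p :=
  ⟨hx, hp, IsElementary.isElementaryInExtension (.base ⟨f, hf, holAt_merAt hp, rfl⟩)⟩

theorem congr (hf : IsElementaryGerm x B f p) (h : f =ᶠ[𝓝 p] g) : IsElementaryGerm x B g p := by
  refine ⟨hf.merAt, holAt_congr hf.holAt h, ?_⟩
  rw [← germ_congr hf.merAt (holAt_merAt hf.holAt) _ h]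
  exact hf.isElementaryInExtension

theorem add (hf : IsElementaryGerm x B f p) (hg : IsElementaryGerm x B g p) :
    IsElementaryGerm x B (fun u => f u + g u) p := by
  refine ⟨hf.merAt, AnalyticAt.fun_add hf.holAt hg.holAt,
    hf.isElementaryInExtension.of_isElementary_pair hg.isElementaryInExtension ?_⟩
  exact germ_add hf.merAt _ _ ▸
    .add (.base (Set.mem_insert _ _)) (.base (Set.mem_insert_of_mem _ rfl))

theorem sub (hf : IsElementaryGerm x B f p) (hg : IsElementaryGerm x B g p) :
    IsElementaryGerm x B (fun u => f u - g u) p := by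
  refine ⟨hf.merAt, AnalyticAt.fun_sub hf.holAt hg.holAt,
    hf.isElementaryInExtension.of_isElementary_pair hg.isElementaryInExtension ?_⟩
  exact germ_sub hf.merAt _ _ ▸
    .sub (.base (Set.mem_insert _ _)) (.base (Set.mem_insert_of_mem _ rfl))

theorem mul (hf : IsElementaryGerm x B f p) (hg : IsElementaryGerm x B g p) :
    IsElementaryGerm x B (fun u => f u * g u) p := by
  refine ⟨hf.merAt, AnalyticAt.fun_mul hf.holAt hg.holAt,
    hf.isElementaryInExtension.of_isElementary_pair hg.isElementaryInExtension ?_⟩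
  exact germ_mul hf.merAt _ _ ▸
    .mul (.base (Set.mem_insert _ _)) (.base (Set.mem_insert_of_mem _ rfl))

theorem div (hf : IsElementaryGerm x B f p) (hg : IsElementaryGerm x B g p) (h : g p ≠ 0) :
    IsElementaryGerm x B (fun u => f u / g u) p := by
  rw [← inChart_self g p] at h
  refine ⟨hf.merAt, AnalyticAt.fun_div hf.holAt hg.holAt h,
    hf.isElementaryInExtension.of_isElementary_pair hg.isElementaryInExtension ?_⟩
  exact (germ_div hf.merAt _ _).trans (div_eq_mul_inv _ _) ▸
    .mul (.base (Set.mem_insert _ _)) (.inv₀ (.base (Set.mem_insert_of_mem _ rfl)))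

theorem solve {n : ℕ} {c : Fin n → U → ℂ} {y : U → ℂ} (hx : MerAt x p)
    (hc : ∀ i, IsElementaryGerm x B (c i) p) (hy : HolAt y p)
    (h : ∀ᶠ u in 𝓝 p, y u ^ n + ∑ i, c i u * y u ^ (i : ℕ) = 0) : IsElementaryGerm x B y p := by
  have hc' (i : Fin n) : MerAt (c i) p := holAt_merAt (hc i).holAt
  refine ⟨hx, hy, .of_isElementary_range (c := fun i => germ hx (hc' i))
    (fun i => (hc i).isElementaryInExtension)
    (.alg (c := fun i => germ hx (hc' i)) (fun i => .base ⟨i, rfl⟩) ?_)⟩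
  simp only [← germ_pow, ← germ_mul]
  rw [← germ_sum, ← germ_add, germ_eq_zero_iff]
  exact eventually_nhdsNE_chart.2 (h.filter_mono nhdsWithin_le_nhds)

end IsElementaryGerm

theorem holAt_exp (hf : HolAt f p) : HolAt (fun u => Complex.exp (f u)) p := AnalyticAt.cexp' hf

theorem germ_exp_mul_germ_exp_neg (hx : MerAt x p) (hf : HolAt f p) :
    germ hx (holAt_merAt (holAt_exp hf)) *
      germ hx (holAt_merAt (holAt_exp (f := fun u => -f u) (AnalyticAt.fun_neg hf))) = 1 := by
  rw [← germ_mul]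
  refine (germ_eq_germ_iff hx (hg := .const 1 _)).2 (.of_forall fun w => ?_)
  exact (Complex.exp_add _ _).symm.trans (by simp)

theorem deriv_germ_exp (hx : MerAt x p) (hf : HolAt f p) :
    (germ hx (holAt_merAt (holAt_exp hf)))′ =
      germ hx (holAt_merAt (holAt_exp hf)) * (germ hx (holAt_merAt hf))′ := by
  rw [deriv_germ, deriv_germ, ← germ_mul, germ_eq_germ_iff]
  filter_upwards [(AnalyticAt.eventually_analyticAt hf).filter_mono nhdsWithin_le_nhds] with w hw
  rw [← mul_div_assoc]
  exact congr($(hw.differentiableAt.hasDerivAt.cexp.deriv) / _)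

namespace IsElementaryGerm

theorem exp (hf : IsElementaryGerm x B f p) :
    IsElementaryGerm x B (fun u => Complex.exp (f u)) p :=
  ⟨hf.merAt, holAt_exp hf.holAt, hf.isElementaryInExtension.of_isElementary_singleton
    (.exp (.base rfl) (germ_exp_mul_germ_exp_neg hf.merAt hf.holAt)
      (deriv_germ_exp hf.merAt hf.holAt))⟩

theorem of_exp (hf : HolAt f p) (h : IsElementaryGerm x B (fun u => Complex.exp (f u)) p) :
    IsElementaryGerm x B f p :=
  ⟨h.merAt, hf, h.isElementaryInExtension.of_isElementary_singleton
    (.log (.base rfl) (germ_exp_mul_germ_exp_neg h.merAt hf)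
      ((mul_comm _ _).trans (deriv_germ_exp h.merAt hf).symm))⟩

end IsElementaryGerm

/-- The variable and the constants. -/
def varConst : Set (ℂ → ℂ) := insert (fun z => z) (Set.range fun c _ => c)

theorem tendsto_nhdsNE_of_not_eventually_const {F : ℂ → ℂ} {z : ℂ} (hF : AnalyticAt ℂ F z)
    (hconst : ¬ ∃ c, F =ᶠ[𝓝[≠] z] fun _ => c) : Tendsto F (𝓝[≠] z) (𝓝[≠] (F z)) :=
  tendsto_nhdsWithin_iff.2 ⟨hF.continuousAt.mono_left nhdsWithin_le_nhds,
    (hF.eventually_eq_or_eventually_ne analyticAt_const).resolve_left fun h =>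
      hconst ⟨_, h.filter_mono nhdsWithin_le_nhds⟩⟩

theorem eventually_eq_self_of_eventually_const (hf : HolAt f p) {c : ℂ}
    (h : inChart f p =ᶠ[𝓝[≠] (chartAt ℂ p p)] fun _ => c) : ∀ᶠ u in 𝓝 p, f u = f p := by
  have hc : ∀ᶠ w in 𝓝 (chartAt ℂ p p), inChart f p w = c :=
    (AnalyticAt.frequently_eq_iff_eventually_eq hf analyticAt_const).1 h.frequently
  have hpc := hc.self_of_nhds
  rw [inChart_self] at hpc
  rw [hpc]
  exact eventually_nhds_chart.1 hc

theorem IsElementaryGerm.comp {φ : ℂ → ℂ} (hB : ∀ c : ℂ, (fun _ => c) ∈ B)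
    (hxconst : ¬ ∃ c, inChart x p =ᶠ[𝓝[≠] (chartAt ℂ p p)] fun _ => c)
    (hφ : IsElementaryGerm (fun z => z) varConst φ (f p)) (hf : IsElementaryGerm x B f p) :
    IsElementaryGerm x B (fun u => φ (f u)) p := by
  by_cases hconst : ∃ c, inChart f p =ᶠ[𝓝[≠] (chartAt ℂ p p)] fun _ => c
  · obtain ⟨c, hc⟩ := hconst
    refine (of_mem hf.merAt (hB (φ (f p))) analyticAt_const).congr ?_
    filter_upwards [eventually_eq_self_of_eventually_const hf.holAt hc] with u hu
    rw [hu]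
  have hx := hf.merAt
  have hF : AnalyticAt ℂ (inChart f p) (chartAt ℂ p p) := hf.holAt
  have hFz := tendsto_nhdsNE_of_not_eventually_const hF hconst
  rw [← inChart_self f p] at hφ
  refine ⟨hx, AnalyticAt.comp (g := φ) (f := inChart f p) hφ.holAt hF, ?_⟩
  have hu : (germ hx hF.meromorphicAt)′ ≠ 0 :=
    div_ne_zero (germ_deriv_ne_zero hx hF.meromorphicAt hconst) (germ_deriv_ne_zero hx hx hxconst)
  refine hf.isElementaryInExtension.comp (germPullback hx hF hFz _) hu
    (deriv_germPullback hx hF hFz) (.deriv (.base (Set.mem_insert _ _))) ?_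
    hφ.isElementaryInExtension
  rintro _ ⟨_, rfl | ⟨c, rfl⟩, _, rfl⟩
  · exact .base (Set.mem_insert _ _)
  · exact .base (Set.mem_insert_of_mem _ ⟨_, hB c, .const c _, rfl⟩)

/-- The functions that are meromorphic at every point of `W`. -/
def meromorphicOn (W : Set U) : Subring (U → ℂ) where
  carrier := {f | ∀ w ∈ W, MerAt f w}
  zero_mem' _ _ := .const 0 _
  one_mem' _ _ := .const 1 _
  add_mem' hf hg w hw := MeromorphicAt.fun_add (hf w hw) (hg w hw)
  mul_mem' hf hg w hw := MeromorphicAt.fun_mul (hf w hw) (hg w hw)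
  neg_mem' hf w hw := MeromorphicAt.fun_neg (hf w hw)

/-- The germ at a point of `W`, as a ring homomorphism. -/
def germHom {W : Set U} (hx : MerAt x p) (hp : p ∈ W) : meromorphicOn W →+* GermField hx where
  toFun f := germ hx (f.2 p hp)
  map_zero' := rfl
  map_one' := rfl
  map_add' _ _ := rfl
  map_mul' _ _ := rfl

theorem germHom_eq_zero_iff {W : Set U} (hx : MerAt x p) (hp : p ∈ W) (a : meromorphicOn W) :
    germHom hx hp a = 0 ↔ ∀ᶠ u in 𝓝[≠] p, (a : U → ℂ) u = 0 :=
  (germ_eq_zero_iff hx (hf := a.2 p hp)).trans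
    (eventually_nhdsNE_chart (P := fun u => (a : U → ℂ) u = 0))

theorem germHom_image {W : Set U} (hx : MerAt x p) (hp : p ∈ W)
    (hB : ∀ b ∈ B, IsMeromorphic b) :
    germHom hx hp '' {a : meromorphicOn W | (a : U → ℂ) ∈ B} = germsOf hx B := by
  ext s
  constructor
  · rintro ⟨a, ha, rfl⟩
    exact ⟨a, ha, a.2 p hp, rfl⟩
  · rintro ⟨b, hb, _, rfl⟩
    exact ⟨⟨b, fun w _ => hB b hb w⟩, hb, rfl⟩

variable [IsManifold 𝓘(ℂ) ω U]

theorem deriv_germ_eq_germ_derivWrt (hx : MerAt x p) (hf : MerAt f p) :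
    (germ hx hf)′ = germ hx (merAt_derivWrt hx hf) :=
  (germ_eq_germ_iff hx (hf := hf.deriv.fun_div hx.deriv)).2
    (inChart_derivWrt_eventuallyEq hx hf).symm

theorem IsElementaryGerm.derivWrt (hf : IsElementaryGerm x B f p) (hx : HolAt x p)
    (h : chartDeriv x p ≠ 0) : IsElementaryGerm x B (derivWrt x f) p := by
  refine ⟨hf.merAt, holAt_derivWrt hx hf.holAt h,
    hf.isElementaryInExtension.of_isElementary_singleton ?_⟩
  rw [← deriv_germ_eq_germ_derivWrt hf.merAt (holAt_merAt hf.holAt)]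
  exact .deriv (.base rfl)

theorem IsElementaryGerm.continuation [T1Space U] (hx : IsMeromorphic x)
    (hB : ∀ b ∈ B, IsMeromorphic b) (hf : IsElementaryGerm x B f p)
    (h : IsDirectContinuation f p g q) : IsElementaryGerm x B g q := by
  obtain ⟨W, -, hW, hp, hq, h, hhol, hhf, hhg⟩ := h
  have hh : IsElementaryGerm x B h p := hf.congr hhf.symm
  refine congr ⟨hx q, hhol q hq, ?_⟩ hhg
  rw [← germHom_image (hx q) hq hB]
  refine .transfer_of_ringHom (germHom (hx p) hp) (germHom (hx q) hq) (fun a ha => ?_)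
    (fun a ha => ?_) (fun a => ?_) (g := ⟨h, fun w hw => holAt_merAt (hhol w hw)⟩) ?_
  · rw [germHom_eq_zero_iff] at ha ⊢
    exact eventually_eq_zero_of_isPreconnected hW a.2 hp hq ha
  · exact ⟨⟨fun u => (a.1 u)⁻¹, fun w hw => (a.2 w hw).fun_inv⟩, mul_inv_cancel₀ ha⟩
  · exact ⟨⟨Liouville.derivWrt x a.1, fun w hw => merAt_derivWrt (hx w) (a.2 w hw)⟩,
      deriv_germ_eq_germ_derivWrt (hx p) (a.2 p hp), deriv_germ_eq_germ_derivWrt (hx q) (a.2 q hq)⟩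
  · rw [germHom_image (hx p) hp hB]
    exact hh.isElementaryInExtension

end ElementaryGerm

section Trigonometric

theorem exp_mul_I_sq_sub_sin_mul (z : ℂ) : Complex.exp (z * Complex.I) ^ 2 -
    2 * Complex.I * Complex.sin z * Complex.exp (z * Complex.I) = 1 := by
  rw [Complex.exp_mul_I]
  linear_combination Complex.sin_sq_add_cos_sq z - Complex.sin z ^ 2 * Complex.I_mul_I

theorem exp_mul_I_sq_sub_cos_mul (z : ℂ) : Complex.exp (z * Complex.I) ^ 2 -
    2 * Complex.cos z * Complex.exp (z * Complex.I) = -1 := by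
  rw [Complex.exp_mul_I]
  linear_combination -Complex.sin_sq_add_cos_sq z + Complex.sin z ^ 2 * Complex.I_mul_I

theorem one_sub_mul_I_ne_zero_of_sin_eq {z w : ℂ} (h : Complex.sin z = w * Complex.cos z) :
    1 - w * Complex.I ≠ 0 := fun h0 => one_ne_zero (α := ℂ) <| by
  linear_combination -Complex.sin_sq_add_cos_sq z + (Complex.sin z + w * Complex.cos z) * h +
    (1 + w * Complex.I) * Complex.cos z ^ 2 * h0 + w ^ 2 * Complex.cos z ^ 2 * Complex.I_mul_I

theorem exp_mul_I_sq_of_sin_eq {z w : ℂ} (h : Complex.sin z = w * Complex.cos z) :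
    Complex.exp (z * Complex.I) ^ 2 = (1 + w * Complex.I) / (1 - w * Complex.I) := by
  rw [eq_div_iff (one_sub_mul_I_ne_zero_of_sin_eq h), Complex.exp_mul_I]
  have := Complex.sin_sq_add_cos_sq z
  rw [h] at this ⊢
  linear_combination (1 + w * Complex.I) * this -
    (1 + w * Complex.I) * w ^ 2 * Complex.cos z ^ 2 * Complex.I_mul_I

end Trigonometric

namespace IsElementaryGerm

variable {U : Type*} [TopologicalSpace U] [ChartedSpace ℂ U] {x f g : U → ℂ} {p : U}
  {B : Set (U → ℂ)} (hB : ∀ c : ℂ, (fun _ => c) ∈ B)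
include hB

theorem const (hx : MerAt x p) (c : ℂ) : IsElementaryGerm x B (fun _ => c) p :=
  of_mem hx (hB c) analyticAt_const

theorem sin (hf : IsElementaryGerm x B f p) :
    IsElementaryGerm x B (fun u => Complex.sin (f u)) p := by
  have hI (c : ℂ) : IsElementaryGerm x B (fun _ => c) p := const hB hf.merAt c
  refine ((((hf.mul (hI (-Complex.I))).exp.sub (hf.mul (hI Complex.I)).exp).mul
    (hI Complex.I)).div (hI 2) two_ne_zero).congr (.of_forall fun u => ?_)
  simp only [Complex.sin, neg_mul, mul_neg]

theorem cos (hf : IsElementaryGerm x B f p) :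
    IsElementaryGerm x B (fun u => Complex.cos (f u)) p := by
  have hI (c : ℂ) : IsElementaryGerm x B (fun _ => c) p := const hB hf.merAt c
  refine (((hf.mul (hI Complex.I)).exp.add (hf.mul (hI (-Complex.I))).exp).div (hI 2)
    two_ne_zero).congr (.of_forall fun u => ?_)
  simp only [Complex.cos, neg_mul, mul_neg]

theorem of_exp_mul_I_quadratic {c₀ c₁ : U → ℂ} (hf : HolAt f p) (h₀ : IsElementaryGerm x B c₀ p)
    (h₁ : IsElementaryGerm x B c₁ p)
    (h : ∀ᶠ u in 𝓝 p, Complex.exp (f u * Complex.I) ^ 2 +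
      (c₀ u + c₁ u * Complex.exp (f u * Complex.I)) = 0) : IsElementaryGerm x B f p := by
  have hfI : HolAt (fun u => f u * Complex.I) p := AnalyticAt.fun_mul hf analyticAt_const
  have hexp : IsElementaryGerm x B (fun u => Complex.exp (f u * Complex.I)) p := by
    refine solve (n := 2) (c := ![c₀, c₁]) h₀.merAt (Fin.forall_fin_two.2 ⟨h₀, h₁⟩)
      (holAt_exp hfI) (h.mono fun u hu => ?_)
    simpa [Fin.sum_univ_two] using hu
  refine ((of_exp hfI hexp).mul (const hB h₀.merAt (-Complex.I))).congr (.of_forall fun u => ?_)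
  linear_combination -f u * Complex.I_mul_I

theorem of_sin (hf : HolAt f p) (h : IsElementaryGerm x B (fun u => Complex.sin (f u)) p) :
    IsElementaryGerm x B f p := by
  have hI (c : ℂ) : IsElementaryGerm x B (fun _ => c) p := const hB h.merAt c
  refine of_exp_mul_I_quadratic hB hf (hI (-1)) ((hI (-2 * Complex.I)).mul h)
    (.of_forall fun u => ?_)
  linear_combination exp_mul_I_sq_sub_sin_mul (f u)

theorem of_cos (hf : HolAt f p) (h : IsElementaryGerm x B (fun u => Complex.cos (f u)) p) :
    IsElementaryGerm x B f p := by
  have hI (c : ℂ) : IsElementaryGerm x B (fun _ => c) p := const hB h.merAt c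
  refine of_exp_mul_I_quadratic hB hf (hI 1) ((hI (-2)).mul h) (.of_forall fun u => ?_)
  linear_combination exp_mul_I_sq_sub_cos_mul (f u)

theorem of_sin_eq_mul_cos (hf : HolAt f p) (hg : IsElementaryGerm x B g p)
    (h : ∀ᶠ u in 𝓝 p, Complex.sin (f u) = g u * Complex.cos (f u)) :
    IsElementaryGerm x B f p := by
  have hI (c : ℂ) : IsElementaryGerm x B (fun _ => c) p := const hB hg.merAt c
  have hgI := hg.mul (hI Complex.I)
  refine of_exp_mul_I_quadratic hB hf ((hI 0).sub (((hI 1).add hgI).div ((hI 1).sub hgI)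
    (one_sub_mul_I_ne_zero_of_sin_eq h.self_of_nhds))) (hI 0) (h.mono fun u hu => ?_)
  linear_combination exp_mul_I_sq_of_sin_eq hu

theorem of_cos_eq_mul_sin (hf : HolAt f p) (hg : IsElementaryGerm x B g p)
    (h : ∀ᶠ u in 𝓝 p, Complex.cos (f u) = g u * Complex.sin (f u)) :
    IsElementaryGerm x B f p := by
  have hI (c : ℂ) : IsElementaryGerm x B (fun _ => c) p := const hB hg.merAt c
  have hquarter : IsElementaryGerm x B (fun u => (Real.pi / 2 : ℂ) - f u) p :=
    of_sin_eq_mul_cos hB (AnalyticAt.fun_sub analyticAt_const hf) hg <| h.mono fun u hu => by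
      rw [Complex.sin_pi_div_two_sub, Complex.cos_pi_div_two_sub, hu]
  exact ((hI _).sub hquarter).congr (.of_forall fun u => sub_sub_cancel _ _)

end IsElementaryGerm

section Plane

variable {f : ℂ → ℂ} {b : ℂ}

theorem merAt_id (b : ℂ) : MerAt (fun z : ℂ => z) b := MeromorphicAt.id b

theorem const_mem_varConst (c : ℂ) : (fun _ => c) ∈ varConst := Set.mem_insert_of_mem _ ⟨c, rfl⟩

theorem isMeromorphic_of_mem_varConst (hf : f ∈ varConst) : IsMeromorphic f := by
  rcases hf with rfl | ⟨c, rfl⟩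
  · exact merAt_id
  · exact fun b => .const c _

theorem derivWrt_id (f : ℂ → ℂ) : derivWrt (fun z => z) f = deriv f :=
  funext fun b => (congrArg (deriv f b / ·) (deriv_id b)).trans (div_one _)

theorem not_eventually_const_id (b : ℂ) : ¬ ∃ c, (fun z => z) =ᶠ[𝓝[≠] b] fun _ => c := by
  rintro ⟨c, hc⟩
  obtain rfl : b = c := tendsto_nhds_unique (tendsto_id.mono_left nhdsWithin_le_nhds)
    (tendsto_const_nhds.congr' hc.symm)
  obtain ⟨z, hz, hzb⟩ := (hc.and self_mem_nhdsWithin).exists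
  exact hzb hz

theorem isElementaryGerm_of_isBasicElementary (hf : IsBasicElementary f b) :
    IsElementaryGerm (fun z => z) varConst f b := by
  have hvar : IsElementaryGerm (fun z => z) varConst (fun z => z) b :=
    .of_mem (merAt_id b) (Set.mem_insert _ _) analyticAt_id
  have hlog {g : ℂ → ℂ} (hg : AnalyticAt ℂ g b) (h : ∀ᶠ z in 𝓝 b, Complex.exp (g z) = z) :
      IsElementaryGerm (fun z => z) varConst g b :=
    .of_exp hg (hvar.congr (EventuallyEq.symm h))
  have hconst (c : ℂ) : IsElementaryGerm (fun z => z) varConst (fun _ => c) b :=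
    .const const_mem_varConst (merAt_id b) c
  cases hf with
  | const c => exact hconst c
  | var => exact hvar
  | exp => exact hvar.exp
  | log _ _ hg h => exact hlog hg h
  | pow α _ g hg h => exact ((hconst α).mul (hlog hg h)).exp
  | sin => exact hvar.sin const_mem_varConst
  | cos => exact hvar.cos const_mem_varConst
  | tan _ hb => exact (hvar.sin const_mem_varConst).div (hvar.cos const_mem_varConst) hb
  | cot _ hb => exact (hvar.cos const_mem_varConst).div (hvar.sin const_mem_varConst) hb
  | arcsin _ g hg h => exact .of_sin const_mem_varConst hg (hvar.congr (EventuallyEq.symm h))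
  | arccos _ g hg h => exact .of_cos const_mem_varConst hg (hvar.congr (EventuallyEq.symm h))
  | arctan _ g hg h => exact .of_sin_eq_mul_cos const_mem_varConst hg hvar h
  | arccot _ g hg h => exact .of_cos_eq_mul_sin const_mem_varConst hg hvar h

theorem isElementaryGerm_of_isGenElementary (hf : IsGenElementary f b) :
    IsElementaryGerm (fun z => z) varConst f b := by
  induction hf with
  | basic hf => exact isElementaryGerm_of_isBasicElementary hf
  | continuation _ h ih =>
    exact ih.continuation merAt_id (fun _ => isMeromorphic_of_mem_varConst) h
  | @comp f g b _ _ ihf ihg =>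
    exact ihf.comp const_mem_varConst (not_eventually_const_id b) ihg
  | add _ _ ihf ihg => exact ihf.add ihg
  | sub _ _ ihf ihg => exact ihf.sub ihg
  | mul _ _ ihf ihg => exact ihf.mul ihg
  | div _ _ h ihf ihg => exact ihf.div ihg h
  | @deriv f b _ ih =>
    rw [← derivWrt_id]
    exact ih.derivWrt analyticAt_id ((deriv_id b).trans_ne one_ne_zero)
  | solve _ hy h ih => exact .solve (merAt_id _) ih hy h

end Plane

section Surface

variable {U : Type*} [TopologicalSpace U] [T1Space U] [ConnectedSpace U] [ChartedSpace ℂ U]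
  {x : U → ℂ}

theorem not_eventually_const_of_isNonconstant (hx : IsMeromorphic x) (hx' : IsNonconstant x)
    (p : U) : ¬ ∃ c, inChart x p =ᶠ[𝓝[≠] (chartAt ℂ p p)] fun _ => c := by
  rintro ⟨c, hc⟩
  have hp : ∀ᶠ u in 𝓝[≠] p, x u - c = 0 := by
    filter_upwards [(eventually_nhdsNE_chart (P := fun u => x u = c)).1 hc] with u hu
    rw [hu, sub_self]
  refine hx' ⟨c, mem_codiscrete.2 fun q => ?_⟩
  rw [disjoint_principal_right, compl_compl]
  filter_upwards [eventually_eq_zero_of_isPreconnected isPreconnected_univ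
    (f := fun u => x u - c) (fun w _ => (hx w).fun_sub (.const c _)) (Set.mem_univ p)
    (Set.mem_univ q) hp] with u hu
  exact sub_eq_zero.1 hu

theorem isElementaryGerm_of_isGenElementaryOver [IsManifold 𝓘(ℂ) ω U] (hx : IsMeromorphic x)
    (hx' : IsNonconstant x) {K : Subalgebra ℂ (U → ℂ)} (hK : ∀ f ∈ K, IsMeromorphic f)
    {f : U → ℂ} {p : U} (hf : IsGenElementaryOver x K f p) : IsElementaryGerm x K f p := by
  induction hf with
  | @basic f p hf hp => exact .of_mem (hx p) hf hp
  | continuation _ h ih => exact ih.continuation hx hK h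
  | @comp φ f p hφ _ ih =>
    exact .comp K.algebraMap_mem (not_eventually_const_of_isNonconstant hx hx' p)
      (isElementaryGerm_of_isGenElementary hφ) ih
  | add _ _ ihf ihg => exact ihf.add ihg
  | sub _ _ ihf ihg => exact ihf.sub ihg
  | mul _ _ ihf ihg => exact ihf.mul ihg
  | div _ _ h ihf ihg => exact ihf.div ihg h
  | deriv _ h1 h2 ih => exact ih.derivWrt h1 h2
  | solve _ hy h ih => exact .solve (hx _) ih hy h

end Surface

section FieldGerms

theorem exists_logForm_of_isElementaryInExtension {C F : Type u} [Field C] [IsAlgClosed C] [Field F]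
    [CharZero F] [Differential F] [Algebra C F] [Differential.ContainConstants C F]
    (hC : ∀ c : C, (algebraMap C F c)′ = 0) (hcard : Cardinal.aleph0 < Cardinal.mk C)
    (E : IntermediateField C F) (hE : ∀ a ∈ E, a′ ∈ E) {y : F}
    (hy : IsElementaryInExtension (E : Set F) y) (hy' : y′ ∈ E) :
    ∃ (m : ℕ) (c : Fin m → C) (u : Fin m → F) (v : F), (∀ i, u i ∈ E ∧ u i ≠ 0) ∧ v ∈ E ∧
      y′ = ∑ i, algebraMap C F (c i) * Differential.logDeriv (u i) + v′ := by
  let := subringDifferential E hE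
  have : DifferentialAlgebra E F := ⟨fun _ => rfl⟩
  have : CharZero E := ⟨fun _ _ h => Nat.cast_injective (R := F) (congrArg Subtype.val h)⟩
  have : Differential.ContainConstants C E := ⟨fun {a} ha => by
    obtain ⟨c, hc⟩ := mem_range_of_deriv_eq_zero C (congrArg Subtype.val ha)
    exact ⟨c, Subtype.ext hc⟩⟩
  obtain ⟨L, _, _, _, _, _, hL⟩ := hy
  let : Algebra E L := ((algebraMap F L).comp (algebraMap E F)).toAlgebra
  have : DifferentialAlgebra E L := ⟨fun a => deriv_algebraMap (B := L) (a : F)⟩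
  have hrange : algebraMap F L '' E = Set.range (algebraMap E L) := by
    rw [RingHom.algebraMap_toAlgebra, RingHom.coe_comp, Set.range_comp]
    exact congrArg _ Subtype.range_coe.symm
  have hform : HasLogForm (⟨y′, hy'⟩ : E) := hasLogForm_of_isElementary_of_aleph0_lt
    (fun c => Subtype.ext (hC c)) hcard (hrange ▸ hL) (deriv_algebraMap y)
  obtain ⟨m, c, u, v, hu, h⟩ := hform.exists_fin C
  refine ⟨m, c, fun i => u i, v, fun i => ⟨(u i).2, fun h0 => hu i (Subtype.ext h0)⟩, v.2,
    (congrArg E.val h).trans ?_⟩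
  simp only [map_add, map_sum, map_mul, Differential.logDeriv, map_div₀]
  rfl

variable {U : Type*} [TopologicalSpace U] [ChartedSpace ℂ U] {x : U → ℂ} {p : U}

/-- The field of germs at `p` of the functions in a field `K` of meromorphic functions. -/
def fieldGerms (hx : MerAt x p) (K : Subalgebra ℂ (U → ℂ)) (hinv : ∀ f ∈ K, f⁻¹ ∈ K) :
    IntermediateField ℂ (GermField hx) where
  carrier := germsOf hx K
  add_mem' := by
    rintro _ _ ⟨f, hf, hfp, rfl⟩ ⟨g, hg, hgp, rfl⟩
    exact ⟨f + g, K.add_mem hf hg, hfp.fun_add hgp, rfl⟩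
  mul_mem' := by
    rintro _ _ ⟨f, hf, hfp, rfl⟩ ⟨g, hg, hgp, rfl⟩
    exact ⟨f * g, K.mul_mem hf hg, hfp.fun_mul hgp, rfl⟩
  algebraMap_mem' c := ⟨_, K.algebraMap_mem c, .const c _, rfl⟩
  inv_mem' := by
    rintro _ ⟨f, hf, hfp, rfl⟩
    exact ⟨f⁻¹, hinv f hf, hfp.fun_inv, rfl⟩

theorem eventually_deriv_eq_sum_of_deriv_germ_eq {X Y R₀ : ℂ → ℂ} {z : ℂ} {m : ℕ}
    {R : Fin m → ℂ → ℂ} {c : Fin m → ℂ} (hX : MeromorphicAt X z) (hY : MeromorphicAt Y z)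
    (hR₀ : MeromorphicAt R₀ z) (hR : ∀ i, MeromorphicAt (R i) z)
    (hconst : ¬ ∃ c, X =ᶠ[𝓝[≠] z] fun _ => c)
    (h : (germ hX hY)′ = ∑ i, algebraMap ℂ (GermField hX) (c i) *
      Differential.logDeriv (germ hX (hR i)) + (germ hX hR₀)′) :
    ∀ᶠ w in 𝓝[≠] z, deriv Y w = ∑ i, c i * (deriv (R i) w / R i w) + deriv R₀ w := by
  have hlog (i : Fin m) : MeromorphicAt (fun w => c i * (deriv (R i) w / deriv X w / R i w)) z :=
    (MeromorphicAt.const (c i) z).fun_mul (((hR i).deriv.fun_div hX.deriv).fun_div (hR i))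
  have hgerm : (∑ i, algebraMap ℂ (GermField hX) (c i) *
      Differential.logDeriv (germ hX (hR i)) + (germ hX hR₀)′) = germ hX
        ((MeromorphicAt.fun_sum fun i (_ : i ∈ Finset.univ) => hlog i).fun_add
          (hR₀.deriv.fun_div hX.deriv)) := by
    rw [germ_add hX (.fun_sum fun i _ => hlog i) (hR₀.deriv.fun_div hX.deriv),
      germ_sum hX Finset.univ hlog]
    rfl
  rw [hgerm, deriv_germ, germ_eq_germ_iff] at h
  have hX0 := hX.deriv.eventually_eq_zero_or_eventually_ne_zero.resolve_left fun h0 =>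
    germ_deriv_ne_zero hX hX hconst ((germ_eq_zero_iff hX).2 h0)
  filter_upwards [h, hX0] with w hw hw0
  rw [div_eq_iff hw0, add_mul, div_mul_cancel₀ _ hw0, Finset.sum_mul] at hw
  rw [hw]
  congr 1
  refine Finset.sum_congr rfl fun i _ => ?_
  rw [div_right_comm, mul_assoc, div_mul_cancel₀ _ hw0]

theorem exists_eventually_deriv_eq_sum [IsManifold 𝓘(ℂ) ω U] {K : Subalgebra ℂ (U → ℂ)}
    (hK : IsFunctionalDifferentialField x K)
    (hxconst : ¬ ∃ c, inChart x p =ᶠ[𝓝[≠] (chartAt ℂ p p)] fun _ => c) {f y : U → ℂ} (hf : f ∈ K)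
    (hy : derivWrt x y =ᶠ[𝓝[≠] p] f) (he : IsElementaryGerm x K y p) :
    ∃ (m : ℕ) (r₀ : U → ℂ) (r : Fin m → U → ℂ) (c : Fin m → ℂ), r₀ ∈ K ∧ (∀ i, r i ∈ K) ∧
      (∀ i, ∀ᶠ w in 𝓝[≠] (chartAt ℂ p p), inChart (r i) p w ≠ 0) ∧
      ∀ᶠ w in 𝓝[≠] (chartAt ℂ p p), deriv (inChart y p) w =
        ∑ i, c i * (deriv (inChart (r i) p) w / inChart (r i) p w) + deriv (inChart r₀ p) w := by
  have hx := he.merAt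
  have hyp := holAt_merAt he.holAt
  have := containConstants_germField hx hxconst
  have : CharZero (GermField hx) :=
    charZero_of_injective_algebraMap (algebraMap ℂ (GermField hx)).injective
  have hy' : (germ hx hyp)′ ∈ fieldGerms hx K hK.inv_mem := by
    refine ⟨f, hf, hK.meromorphic f hf p, ?_⟩
    rw [deriv_germ_eq_germ_derivWrt, germ_eq_germ_iff]
    exact eventually_nhdsNE_chart.2 hy.symm
  obtain ⟨m, c, u, v, hu, ⟨r₀, hr₀, hr₀p, rfl⟩, h⟩ := exists_logForm_of_isElementaryInExtension
    (deriv_algebraMap_complex hx) (Cardinal.mk_complex ▸ Cardinal.aleph0_lt_continuum)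
    (fieldGerms hx K hK.inv_mem) (by
      rintro _ ⟨g, hg, hgp, rfl⟩
      exact ⟨_, hK.deriv_mem g hg, merAt_derivWrt hx hgp,
        (deriv_germ_eq_germ_derivWrt hx hgp).symm⟩) he.isElementaryInExtension hy'
  choose r hr hrp hru using fun i => (hu i).1
  refine ⟨m, r₀, r, c, hr₀, hr, fun i => ?_, ?_⟩
  · refine (hrp i).eventually_eq_zero_or_eventually_ne_zero.resolve_left fun h0 => (hu i).2 ?_
    rw [← hru, germ_eq_zero_iff]
    exact h0
  · simp only [← hru] at h
    exact eventually_deriv_eq_sum_of_deriv_germ_eq hx hyp hr₀p hrp hxconst h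

end FieldGerms

section LogBranch

/-- The branch of the logarithm near `exp a` that takes the value `a` at `exp a`. -/
def logBranch (a z : ℂ) : ℂ := Complex.log (z / Complex.exp a) + a

theorem analyticAt_logBranch (a : ℂ) : AnalyticAt ℂ (logBranch a) (Complex.exp a) := by
  refine (analyticAt_id.div_const.clog ?_).add analyticAt_const
  rw [id, div_self (Complex.exp_ne_zero a)]
  exact Complex.one_mem_slitPlane

theorem exp_logBranch (a : ℂ) {z : ℂ} (hz : z ≠ 0) : Complex.exp (logBranch a z) = z := by
  rw [logBranch, Complex.exp_add, Complex.exp_log (div_ne_zero hz (Complex.exp_ne_zero a)),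
    div_mul_cancel₀ _ (Complex.exp_ne_zero a)]

theorem eventually_logBranch_exp (a : ℂ) : ∀ᶠ b in 𝓝 a, logBranch a (Complex.exp b) = b := by
  have him : Tendsto (fun b => |(b - a).im|) (𝓝 a) (𝓝 0) := by
    have hcont : Continuous fun b => |(b - a).im| := by fun_prop
    simpa only [sub_self, Complex.zero_im, abs_zero] using hcont.tendsto a
  filter_upwards [him.eventually_lt_const Real.pi_pos] with b hb
  obtain ⟨hlow, hup⟩ := abs_lt.1 hb
  rw [logBranch, ← Complex.exp_sub, Complex.log_exp hlow hup.le, sub_add_cancel]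

end LogBranch

section LogSum

variable {U : Type*} [TopologicalSpace U] [ChartedSpace ℂ U] {y r₀ : U → ℂ} {m : ℕ}
  {r : Fin m → U → ℂ} {c : Fin m → ℂ} {q : U}

/-- The identity `y = r₀ + ∑ cᵢ ln rᵢ` near `q`, for suitable branches of the logarithms. -/
def IsLogSumAt (y r₀ : U → ℂ) {m : ℕ} (r : Fin m → U → ℂ) (c : Fin m → ℂ) (q : U) : Prop :=
  ∃ L : Fin m → U → ℂ, (∀ i, IsLogBranch (r i) (L i) q) ∧
    ∀ᶠ u in 𝓝 q, y u = r₀ u + ∑ i, c i * L i u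

namespace IsLogSumAt

theorem eventually [IsManifold 𝓘(ℂ) ω U] (h : IsLogSumAt y r₀ r c q) :
    ∀ᶠ u in 𝓝 q, IsLogSumAt y r₀ r c u := by
  obtain ⟨L, hL, hsum⟩ := h
  filter_upwards [eventually_all.2 fun i => (eventually_holAt_of_holAt (hL i).1).and
    (hL i).2.eventually_nhds, hsum.eventually_nhds] with u hLu hsumu
  exact ⟨L, hLu, hsumu⟩

theorem add_const_iff {C : ℂ} (h : IsLogSumAt y (fun u => r₀ u + C) r c q) (C' : ℂ) :
    IsLogSumAt y (fun u => r₀ u + C') r c q ↔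
      ∃ n : Fin m → ℤ, C = C' + ∑ i, c i * (n i * (2 * Real.pi * Complex.I)) := by
  obtain ⟨L, hL, hsum⟩ := h
  constructor
  · rintro ⟨L', hL', hsum'⟩
    choose n hn using fun i => Complex.exp_eq_exp_iff_exists_int.1
      ((hL' i).2.self_of_nhds.trans (hL i).2.self_of_nhds.symm)
    refine ⟨n, ?_⟩
    have hq := hsum.self_of_nhds.symm.trans hsum'.self_of_nhds
    simp only [hn, mul_add, Finset.sum_add_distrib] at hq
    linear_combination hq
  · rintro ⟨n, rfl⟩
    refine ⟨fun i u => L i u + n i * (2 * Real.pi * Complex.I), fun i =>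
      ⟨AnalyticAt.add (hL i).1 analyticAt_const, ?_⟩, ?_⟩
    · filter_upwards [(hL i).2] with u hu
      rw [Complex.exp_add, Complex.exp_int_mul_two_pi_mul_I, mul_one, hu]
    · filter_upwards [hsum] with u hu
      simp only [hu, mul_add, Finset.sum_add_distrib]
      ring

end IsLogSumAt

theorem exists_forall_isLogSumAt_of_isPreconnected [IsManifold 𝓘(ℂ) ω U] {W : Set U}
    (hW : IsPreconnected W)
    (h : ∀ w ∈ W, ∃ C : ℂ, IsLogSumAt y (fun u => r₀ u + C) r c w) :
    ∃ C : ℂ, ∀ w ∈ W, IsLogSumAt y (fun u => r₀ u + C) r c w := by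
  rcases W.eq_empty_or_nonempty with rfl | ⟨w₀, hw₀⟩
  · exact ⟨0, fun w hw => hw.elim⟩
  obtain ⟨C, hC⟩ := h w₀ hw₀
  refine ⟨C, fun w hw => (hW.induction₂ (fun a b => IsLogSumAt y (fun u => r₀ u + C) r c a ↔
    IsLogSumAt y (fun u => r₀ u + C) r c b) (fun a ha => ?_) (fun _ _ _ _ _ _ => Iff.trans)
    (fun _ _ _ _ => Iff.symm) hw₀ hw).1 hC⟩
  -- By `IsLogSumAt.add_const_iff`, the admissible constants form the same coset near `a`.
  obtain ⟨C', hC'⟩ := h a ha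
  filter_upwards [hC'.eventually.filter_mono nhdsWithin_le_nhds] with u hu
  rw [hC'.add_const_iff, hu.add_const_iff]

theorem eventually_deriv_logBranch_comp {R : ℂ → ℂ} {a w : ℂ} (hR : AnalyticAt ℂ R w)
    (ha : Complex.exp a = R w) :
    ∀ᶠ v in 𝓝 w, HasDerivAt (fun v => logBranch a (R v)) (deriv R v / R v) v := by
  have hlog : AnalyticAt ℂ (fun v => logBranch a (R v)) w :=
    (analyticAt_logBranch a).comp_of_eq hR ha.symm
  have hR0 : ∀ᶠ v in 𝓝 w, R v ≠ 0 :=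
    hR.continuousAt.eventually_ne (ha ▸ Complex.exp_ne_zero a)
  filter_upwards [hlog.eventually_analyticAt, hR0.eventually_nhds] with v hv hv0
  have hexp : (fun v => Complex.exp (logBranch a (R v))) =ᶠ[𝓝 v] R :=
    hv0.mono fun _ => exp_logBranch a
  have hd := hexp.deriv_eq.symm.trans hv.differentiableAt.hasDerivAt.cexp.deriv
  rw [hd, exp_logBranch a hv0.self_of_nhds, mul_div_cancel_left₀ _ hv0.self_of_nhds]
  exact hv.differentiableAt.hasDerivAt

theorem exists_isLogSumAt_of_eventually_deriv_eq {Y R₀ : ℂ → ℂ} {R : Fin m → ℂ → ℂ} {w : ℂ}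
    (hY : AnalyticAt ℂ Y w) (hR₀ : AnalyticAt ℂ R₀ w) (hR : ∀ i, AnalyticAt ℂ (R i) w)
    (hR0 : ∀ i, R i w ≠ 0)
    (h : ∀ᶠ v in 𝓝 w, deriv Y v = ∑ i, c i * (deriv (R i) v / R i v) + deriv R₀ v) :
    ∃ C : ℂ, IsLogSumAt Y (fun v => R₀ v + C) R c w := by
  let L i v := logBranch (Complex.log (R i w)) (R i v)
  have hexp i : Complex.exp (Complex.log (R i w)) = R i w := Complex.exp_log (hR0 i)
  have hL i : AnalyticAt ℂ (L i) w :=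
    (analyticAt_logBranch _).comp_of_eq (hR i) (hexp i).symm
  have hderiv : ∀ᶠ v in 𝓝 w, HasDerivAt (fun v => Y v - R₀ v - ∑ i, c i * L i v) 0 v := by
    filter_upwards [h, hY.eventually_analyticAt, hR₀.eventually_analyticAt,
      eventually_all.2 fun i => eventually_deriv_logBranch_comp (hR i) (hexp i)]
      with v hv hYv hR₀v hLv
    refine ((hYv.differentiableAt.hasDerivAt.fun_sub hR₀v.differentiableAt.hasDerivAt).fun_sub
      (.fun_sum fun i _ => (hLv i).const_mul (c i))).congr_deriv ?_
    rw [hv]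
    ring
  obtain ⟨ρ, hρ, hball⟩ := Metric.eventually_nhds_iff_ball.1 hderiv
  obtain ⟨C, hC⟩ := Metric.isOpen_ball.exists_is_const_of_deriv_eq_zero
    Metric.isPreconnected_ball
    (fun v hv => (hball v hv).differentiableAt.differentiableWithinAt)
    (fun v hv => (hball v hv).deriv)
  refine ⟨C, L, fun i => ⟨hL i, ?_⟩, ?_⟩
  · exact ((hR i).continuousAt.eventually_ne (hR0 i)).mono fun v => exp_logBranch _
  · filter_upwards [Metric.ball_mem_nhds w hρ] with v hv
    linear_combination hC v hv

theorem isLogSumAt_of_inChart [IsManifold 𝓘(ℂ) ω U] {p : U} (hq : q ∈ (chartAt ℂ p).source)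
    (h : IsLogSumAt (inChart y p) (inChart r₀ p) (fun i => inChart (r i) p) c (chartAt ℂ p q)) :
    IsLogSumAt y r₀ r c q := by
  obtain ⟨L, hL, hsum⟩ := h
  have hcont := (chartAt ℂ p).continuousAt hq
  have hsource := (chartAt ℂ p).open_source.mem_nhds hq
  refine ⟨fun i u => L i (chartAt ℂ p u), fun i => ⟨?_, ?_⟩, ?_⟩
  · refine (holAt_iff hq).2 ((hL i).1.congr ?_)
    filter_upwards [(chartAt ℂ p).open_target.mem_nhds ((chartAt ℂ p).map_source hq)] with w hw
    exact congrArg (L i) ((chartAt ℂ p).right_inv hw).symm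
  · filter_upwards [hcont.eventually (hL i).2, hsource] with u hu hus
    exact hu.trans (congrArg (r i) ((chartAt ℂ p).left_inv hus))
  · filter_upwards [hcont.eventually hsum, hsource] with u hu hus
    simpa only [inChart, Function.comp_apply, (chartAt ℂ p).left_inv hus] using hu

theorem isLogSum_of_eventually_deriv_eq [IsManifold 𝓘(ℂ) ω U] {K : Subalgebra ℂ (U → ℂ)}
    (hK : ∀ g ∈ K, IsMeromorphic g) {p : U} (hy : HolAt y p) (hr₀ : r₀ ∈ K)
    (hr : ∀ i, r i ∈ K) (hr0 : ∀ i, ∀ᶠ w in 𝓝[≠] (chartAt ℂ p p), inChart (r i) p w ≠ 0)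
    (h : ∀ᶠ w in 𝓝[≠] (chartAt ℂ p p), deriv (inChart y p) w =
      ∑ i, c i * (deriv (inChart (r i) p) w / inChart (r i) p w) + deriv (inChart r₀ p) w) :
    IsLogSum K y p := by
  have hlocal : ∀ᶠ w in 𝓝[≠] (chartAt ℂ p p), ∃ C : ℂ,
      IsLogSumAt (inChart y p) (fun v => inChart r₀ p v + C) (fun i => inChart (r i) p) c w := by
    filter_upwards [(AnalyticAt.meromorphicAt hy).eventually_analyticAt,
      (hK r₀ hr₀ p).eventually_analyticAt,
      eventually_all.2 fun i => (hK _ (hr i) p).eventually_analyticAt, eventually_all.2 hr0,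
      eventually_eventually_nhdsWithin.2 h, self_mem_nhdsWithin] with w hYw hR₀w hRw hR0w hw hne
    exact exists_isLogSumAt_of_eventually_deriv_eq hYw hR₀w hRw hR0w
      (isOpen_compl_singleton.nhdsWithin_eq hne ▸ hw)
  obtain ⟨ρ, hρ, hball⟩ := Metric.mem_nhdsWithin_iff.1 hlocal
  obtain ⟨C, hC⟩ := exists_forall_isLogSumAt_of_isPreconnected
    (isPreconnected_punctured_ball (chartAt ℂ p p) hρ) hball
  refine ⟨m, r₀ + algebraMap ℂ _ C, r, c, K.add_mem hr₀ (K.algebraMap_mem C), hr, ?_⟩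
  filter_upwards [(tendsto_chart_nhdsNE p).eventually
    (inter_mem (mem_nhdsWithin_of_mem_nhds (Metric.ball_mem_nhds _ hρ)) self_mem_nhdsWithin),
    (eventually_mem_chart_source p).filter_mono nhdsWithin_le_nhds] with q hq hqs
  exact isLogSumAt_of_inChart hqs (hC _ hq)

end LogSum

section Converse

variable {U : Type*} [TopologicalSpace U] [ChartedSpace ℂ U] {x y f g : U → ℂ}
  {K : Subalgebra ℂ (U → ℂ)} {p q : U}

theorem exists_isGenElementaryOver_eventuallyEq_of_isLogBranch {r L : U → ℂ} (hr : r ∈ K)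
    (hrq : HolAt r q) (h : IsLogBranch r L q) :
    ∃ L', IsGenElementaryOver x K L' q ∧ L' =ᶠ[𝓝 q] L := by
  have hexp := h.2.self_of_nhds
  have hlog : IsGenElementary (logBranch (L q)) (r q) := by
    refine .basic (.log _ _ (hexp ▸ analyticAt_logBranch (L q)) ?_)
    filter_upwards [isOpen_ne.mem_nhds (hexp ▸ Complex.exp_ne_zero (L q))] with z hz
    exact exp_logBranch (L q) hz
  refine ⟨_, .comp hlog (.basic hr hrq), ?_⟩
  filter_upwards [h.2, (continuousAt_of_holAt h.1).eventually (eventually_logBranch_exp (L q))]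
    with u hu hLu
  rw [← hu, hLu]

theorem isGenElementaryOver_sum {ι : Type*} {f : ι → U → ℂ} (s : Finset ι)
    (hf : ∀ i ∈ s, IsGenElementaryOver x K (f i) q) :
    IsGenElementaryOver x K (fun u => ∑ i ∈ s, f i u) q := by
  induction s using Finset.cons_induction with
  | empty => exact .basic K.zero_mem analyticAt_const
  | cons i s hi ih =>
    simp only [Finset.sum_cons]
    exact (hf i (Finset.mem_cons_self i s)).add
      (ih fun j hj => hf j (Finset.mem_cons_of_mem hj))

theorem eventually_isDirectContinuation [IsManifold 𝓘(ℂ) ω U] (hf : HolAt f p) :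
    ∀ᶠ q in 𝓝 p, IsDirectContinuation f q f p := by
  have := ChartedSpace.locallyConnectedSpace ℂ U
  obtain ⟨W, ⟨hopen, hpW, hconn⟩, hW⟩ :=
    (LocallyConnectedSpace.open_connected_basis p).mem_iff.1 (eventually_holAt_of_holAt hf)
  filter_upwards [hopen.mem_nhds hpW] with q hqW
  exact ⟨W, hopen, hconn.isPreconnected, hqW, hpW, f, hW, .rfl, .rfl⟩

theorem isGenElementaryOver_of_isLogSumAt {r₀ : U → ℂ} {m : ℕ} {r : Fin m → U → ℂ}
    {c : Fin m → ℂ} (hr₀ : r₀ ∈ K) (hr : ∀ i, r i ∈ K) (hr₀q : HolAt r₀ q)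
    (hrq : ∀ i, HolAt (r i) q) (h : IsLogSumAt y r₀ r c q) :
    ∃ y', IsGenElementaryOver x K y' q ∧ y' =ᶠ[𝓝 q] y := by
  obtain ⟨L, hL, hsum⟩ := h
  choose L' hL' hLL' using fun i =>
    exists_isGenElementaryOver_eventuallyEq_of_isLogBranch (x := x) (hr i) (hrq i) (hL i)
  refine ⟨_, .add (.basic hr₀ hr₀q) (isGenElementaryOver_sum Finset.univ fun i _ =>
    .mul (.basic (K.algebraMap_mem (c i)) analyticAt_const) (hL' i)), ?_⟩
  filter_upwards [hsum, eventually_all.2 hLL'] with u hu hu'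
  rw [hu]
  simp only [hu']
  rfl

theorem isGenElementaryOver_of_isLogSum [IsManifold 𝓘(ℂ) ω U]
    (hK : ∀ g ∈ K, IsMeromorphic g) (hy : HolAt y p) (h : IsLogSum K y p) :
    IsGenElementaryOver x K y p := by
  obtain ⟨m, r₀, r, c, hr₀, hr, hsum⟩ := h
  obtain ⟨q, hq, hr₀q, hrq, hcont⟩ := (hsum.and <|
    (eventually_holAt_of_merAt (hK r₀ hr₀ p)).and <|
    (eventually_all.2 fun i => eventually_holAt_of_merAt (hK _ (hr i) p)).and <|
    (eventually_isDirectContinuation hy).filter_mono nhdsWithin_le_nhds).exists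
  obtain ⟨y', hy', hyy'⟩ := isGenElementaryOver_of_isLogSumAt (x := x) hr₀ hr hr₀q hrq hq
  obtain ⟨W, hopen, hconn, hqW, hpW, g, hg, hgq, hgp⟩ := hcont
  exact .continuation hy' ⟨W, hopen, hconn, hqW, hpW, g, hg, hgq.trans hyy'.symm, hgp⟩

end Converse

end ElementaryIntegral

end

theorem mainTheorem1 {U : Type*} [TopologicalSpace U] [T2Space U] [ConnectedSpace U]
    [ChartedSpace ℂ U] [IsManifold 𝓘(ℂ) ω U]
    (x : U → ℂ) (hx : Liouville.IsMeromorphic x) (hx' : Liouville.IsNonconstant x)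
    (K : Subalgebra ℂ (U → ℂ)) (hK : Liouville.IsFunctionalDifferentialField x K)
    (f : U → ℂ) (hf : f ∈ K)
    (y : U → ℂ) (p : U) (hy : Liouville.IsIntegralOf x f y p) :
    Liouville.IsGenElementaryOver x K y p ↔ Liouville.IsLogSum K y p := by
  refine ⟨fun h => ?_, ElementaryIntegral.isGenElementaryOver_of_isLogSum hK.meromorphic hy.1⟩
  obtain ⟨m, r₀, r, c, hr₀, hr, hr0, hderiv⟩ :=
    ElementaryIntegral.exists_eventually_deriv_eq_sum hK
      (ElementaryIntegral.not_eventually_const_of_isNonconstant hx hx' p) hf hy.2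
      (ElementaryIntegral.isElementaryGerm_of_isGenElementaryOver hx hx' hK.meromorphic h)
  exact ElementaryIntegral.isLogSum_of_eventually_deriv_eq hK.meromorphic hy.1 hr₀ hr hr0 hderiv
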